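/- Let $\mathbb{P}=\mathbb{P}^1_{\mathbb{Z}}=\operatorname{Proj}\mathbb{Z}[x_0,x_1]$ with standard affine opens $U_i=D_+(x_i)$, let $n\in\mathbb{Z}$ and $k\ge 1$. Let $p,q:\mathbb{P}\times_{\mathbb{Z}}\mathbb{P}\to\mathbb{P}$ be the two projections, $\mathcal{I}$ the ideal sheaf of the diagonal, $\mathcal{O}_{\Delta^k}=\mathcal{O}_{\mathbb{P}\times\mathbb{P}}/\mathcal{I}^{k+1}$, and let $\mathcal{P}^k(\mathcal{O}(n))=p_*(\mathcal{O}_{\Delta^k}\otimes q^*\mathcal{O}(n))$ be the sheaf of principal parts, regarded as a right $\mathcal{O}_{\mathbb{P}}$-module, that is, with functions acting through the second factor $q$. Put $t=\frac{x_1}{x_0}\otimes 1$ and $u=1\otimes\frac{x_1}{x_0}$ and write $du^p=(t-u)^p$ over $U_0$; put $v=1\otimes\frac{x_0}{x_1}=1/u$ and write $dv^p=\left(\frac{x_0}{x_1}\otimes 1-v\right)^p$ over $U_1$. For a local section $s$ of $\mathcal{O}(n)$, let $1\otimes s$ be its pullback along $q$. Then $D=\{1\otimes x_0^n,\,du\otimes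 x_0^n,\dots,du^k\otimes x_0^n\}$ is a basis of $\mathcal{P}^k(\mathcal{O}(n))(U_0)$ as a right $\mathcal{O}(U_0)$-module, $D'=\{1\otimes x_1^n,\,dv\otimes x_1^n,\dots,dv^k\otimes x_1^n\}$ is a basis of $\mathcal{P}^k(\mathcal{O}(n))(U_1)$ as a right $\mathcal{O}(U_1)$-module, and both restrict to bases of $\mathcal{P}^k(\mathcal{O}(n))(U_0\cap U_1)$ as a right $\mathcal{O}(U_0\cap U_1)$-module. Over $U_0\cap U_1$ one has $$1\otimes x_1^n=u^n\otimes x_0^n$$ and, for $1\le p\le k$, $$dv^p\otimes x_1^n=\sum_{j=p}^{k}(-1)^j\binom{j-1}{p-1}u^{n-p-j}\,du^j\otimes x_0^n .$$ Equivalently, the transition matrix $R^k_n=[I]^{D'}_{D}$, with rows and columns indexed by $0,\dots,k$, has entries $(R^k_n)_{0,0}=u^n$, $(R^k_n)_{j,0}=0$ for $j\ge1$, and, for $p\ge1$, $(R^k_n)_{j,p}=(-1)^j\binom{j-1}{p-1}u^{n-p-j}$ if $j\ge p$ and $(R^k_n)_{j,p}=0$ if $j<p$. -/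

import Mathlib

open CategoryTheory AlgebraicGeometry TopologicalSpace Opposite

universe u

noncomputable section

/-! ## The sheaves `𝒪(n)` on `Proj` of a graded ring -/

namespace SerreTwist

variable {σ : Type*} {A : Type u} [CommRing A] [SetLike σ A] [AddSubgroupClass σ A]
variable (𝒜 : ℕ → σ) [GradedRing 𝒜] (n : ℤ)

/-- The local ring `A_𝔭` of `A` at the homogeneous prime `𝔭` underlying a point of `Proj`.  The
stalk of `𝒪(n)` at the point is the group of homogeneous fractions of degree `n` in it. -/
abbrev Loc (x : ProjectiveSpectrum 𝒜) : Type u :=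
  Localization.AtPrime x.asHomogeneousIdeal.toIdeal

/-- A function on `U` that is a single fraction `a / b` with `a`, `b` homogeneous of degrees
`i`, `j` with `i - j = n` and `b` outside every prime in `U`. -/
def IsFraction {U : Opens (ProjectiveSpectrum.top 𝒜)}
    (s : ∀ x : U, Loc 𝒜 (x.1 : ProjectiveSpectrum 𝒜)) : Prop :=
  ∃ (i j : ℕ) (a : 𝒜 i) (b : 𝒜 j), (i : ℤ) - j = n ∧ ∀ x : U,
    ∃ hb : (b : A) ∉ (x.1 : ProjectiveSpectrum 𝒜).asHomogeneousIdeal.toIdeal,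
      s x = Localization.mk (a : A) ⟨(b : A), hb⟩

def isFractionPrelocal :
    TopCat.PrelocalPredicate (fun x : ProjectiveSpectrum.top 𝒜 => Loc 𝒜 x) where
  pred {_} s := IsFraction 𝒜 n s
  res := by
    rintro V U f s ⟨i, j, a, b, h, w⟩
    exact ⟨i, j, a, b, h, fun x => w (f x)⟩

/-- Functions that are locally fractions of degree `n`. -/
def isLocallyFraction :
    TopCat.LocalPredicate (fun x : ProjectiveSpectrum.top 𝒜 => Loc 𝒜 x) :=
  (isFractionPrelocal 𝒜 n).sheafify

lemma exists_homogeneous_notMem (x : ProjectiveSpectrum 𝒜) :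
    ∃ (d : ℕ) (b : 𝒜 d), 0 < d ∧ (b : A) ∉ x.asHomogeneousIdeal.toIdeal := by
  classical
  by_contra! h
  refine x.not_irrelevant_le fun z hz ↦ ?_
  rw [← DirectSum.sum_support_decompose 𝒜 z]
  refine x.asHomogeneousIdeal.toIdeal.sum_mem fun d hd ↦ h d _ (Nat.pos_of_ne_zero ?_)
  rintro rfl
  rw [HomogeneousIdeal.mem_irrelevant_iff, GradedRing.proj_apply] at hz
  exact DFinsupp.mem_support_iff.mp hd (Subtype.ext hz)

/-- The sections of `𝒪(n)` over `U`, as an additive group. -/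
def sections (U : Opens (ProjectiveSpectrum.top 𝒜)) :
    AddSubgroup (∀ x : U, Loc 𝒜 (x.1 : ProjectiveSpectrum 𝒜)) where
  carrier := {s | (isLocallyFraction 𝒜 n).pred s}
  zero_mem' x := by
    obtain ⟨d, b, hd, hb⟩ := exists_homogeneous_notMem 𝒜 (x.1 : ProjectiveSpectrum 𝒜)
    refine ⟨U ⊓ ProjectiveSpectrum.basicOpen 𝒜 (b : A), ⟨x.2, hb⟩, homOfLE inf_le_left,
      ((n.natAbs * d : ℕ) + n).toNat, n.natAbs * d, ⟨0, zero_mem _⟩,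
      ⟨(b : A) ^ n.natAbs, by simpa using SetLike.pow_mem_graded n.natAbs b.2⟩, ?_, ?_⟩
    · have : (n.natAbs : ℤ) ≤ (n.natAbs * d : ℕ) := by
        exact_mod_cast Nat.le_mul_of_pos_right _ hd
      omega
    · intro y
      exact ⟨fun h => y.2.2 (Ideal.IsPrime.mem_of_pow_mem (ProjectiveSpectrum.isPrime y.1) _ h),
        (Localization.mk_zero _).symm⟩
  add_mem' {s t} hs ht x := by
    obtain ⟨V, hV, iV, i, j, a, b, h, w⟩ := hs x
    obtain ⟨V', hV', iV', i', j', a', b', h', w'⟩ := ht x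
    refine ⟨V ⊓ V', ⟨hV, hV'⟩, homOfLE (inf_le_left.trans iV.le), i + j', j + j',
      ⟨(b : A) * a' + b' * a, add_mem ?_ ?_⟩, ⟨(b : A) * b', SetLike.mul_mem_graded b.2 b'.2⟩,
      by push_cast; omega, ?_⟩
    · have : i + j' = j + i' := by omega
      rw [this]
      exact SetLike.mul_mem_graded b.2 a'.2
    · rw [add_comm i]
      exact SetLike.mul_mem_graded b'.2 a.2
    · intro y
      obtain ⟨hb, e⟩ := w ⟨y.1, y.2.1⟩
      obtain ⟨hb', e'⟩ := w' ⟨y.1, y.2.2⟩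
      exact ⟨Submonoid.mul_mem (Ideal.primeCompl (hp := ProjectiveSpectrum.isPrime y.1) _) hb hb',
        (congr($e + $e')).trans (Localization.add_mk _ _ _ _)⟩
  neg_mem' {s} hs x := by
    obtain ⟨V, hV, iV, i, j, a, b, h, w⟩ := hs x
    refine ⟨V, hV, iV, i, j, ⟨-(a : A), neg_mem a.2⟩, b, h, fun y => ?_⟩
    obtain ⟨hb, e⟩ := w y
    exact ⟨hb, (congr(- $e)).trans (Localization.neg_mk _ _)⟩

/-- `𝒪(n)` as a sheaf of sets. -/
def sheafInType : TopCat.Sheaf (Type u) (ProjectiveSpectrum.top 𝒜) :=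
  TopCat.subsheafToTypes (isLocallyFraction 𝒜 n)

instance (U : (Opens (ProjectiveSpectrum.top 𝒜))ᵒᵖ) :
    AddCommGroup ((sheafInType 𝒜 n).obj.obj U) :=
  (sections 𝒜 n U.unop).toAddCommGroup

/-- `𝒪(n)` as a presheaf of abelian groups. -/
def presheafInAb : TopCat.Presheaf Ab.{u} (ProjectiveSpectrum.top 𝒜) where
  obj U := AddCommGrpCat.of ((sheafInType 𝒜 n).obj.obj U)
  map i := AddCommGrpCat.ofHom
    { toFun := (sheafInType 𝒜 n).obj.map i
      map_zero' := rfl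
      map_add' _ _ := rfl }

lemma smul_mem (U : Opens (ProjectiveSpectrum.top 𝒜))
    (r : (ProjectiveSpectrum.Proj.structureSheaf 𝒜).obj.obj (op U))
    (s : sections 𝒜 n U) :
    (fun x : U => (r.1 x).val * s.1 x) ∈ sections 𝒜 n U := by
  intro x
  obtain ⟨V, hV, iV, i, a, b, hb, w⟩ := r.2 x
  obtain ⟨V', hV', iV', i', j', a', b', h', w'⟩ := s.2 x
  refine ⟨V ⊓ V', ⟨hV, hV'⟩, homOfLE (inf_le_left.trans iV.le), i + i', i + j',
      ⟨(a : A) * a', SetLike.mul_mem_graded a.2 a'.2⟩,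
      ⟨(b : A) * b', SetLike.mul_mem_graded b.2 b'.2⟩,
      by push_cast; omega, ?_⟩
  intro y
  have e := w ⟨y.1, y.2.1⟩
  obtain ⟨hb', e'⟩ := w' ⟨y.1, y.2.2⟩
  refine ⟨Submonoid.mul_mem (Ideal.primeCompl (hp := ProjectiveSpectrum.isPrime y.1) _) (hb ⟨y.1, y.2.1⟩) hb', ?_⟩
  have e2 := congrArg HomogeneousLocalization.val e
  exact (congr($e2 * $e')).trans (Localization.mk_mul _ _ _ _)

/-- Sections of the structure sheaf multiply sections of `𝒪(n)` pointwise. -/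
instance (U : (Opens (ProjectiveSpectrum.top 𝒜))ᵒᵖ) :
    Module ((ProjectiveSpectrum.Proj.structureSheaf 𝒜).obj.obj U)
      ((sheafInType 𝒜 n).obj.obj U) where
  smul r s := ⟨fun x => (r.1 x).val * s.1 x, smul_mem 𝒜 n U.unop r s⟩
  one_smul s := Subtype.ext <| funext fun x => by
    exact (congrArg (· * s.1 x) HomogeneousLocalization.val_one).trans (one_mul _)
  mul_smul r r' s := Subtype.ext <| funext fun x => by
    exact (congrArg (· * s.1 x) (HomogeneousLocalization.val_mul _ _)).trans (mul_assoc _ _ _)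
  smul_zero r := Subtype.ext <| funext fun x => mul_zero _
  smul_add r s t := Subtype.ext <| funext fun x => mul_add _ _ _
  add_smul r r' s := Subtype.ext <| funext fun x => by
    exact (congrArg (· * s.1 x) (HomogeneousLocalization.val_add _ _)).trans (add_mul _ _ _)
  zero_smul s := Subtype.ext <| funext fun x => by
    exact (congrArg (· * s.1 x) HomogeneousLocalization.val_zero).trans (zero_mul _)

/-- `𝒪(n)` as a presheaf of modules over the structure sheaf. -/
def presheafOfModules :
    PresheafOfModules.{u} ((ProjectiveSpectrum.Proj.structureSheaf 𝒜).obj ⋙ forget₂ _ RingCat) :=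
  letI (U : (Opens (ProjectiveSpectrum.top 𝒜))ᵒᵖ) :
      Module (((ProjectiveSpectrum.Proj.structureSheaf 𝒜).obj ⋙ forget₂ CommRingCat RingCat).obj U)
        ((presheafInAb 𝒜 n).obj U) :=
    inferInstanceAs (Module ((ProjectiveSpectrum.Proj.structureSheaf 𝒜).obj.obj U)
      ((sheafInType 𝒜 n).obj.obj U))
  .ofPresheaf (presheafInAb 𝒜 n) fun _ _ _ _ _ => rfl

end SerreTwist

/-- The sheaf of modules `𝒪(n)` on `Proj 𝒜`, for `n` an integer: its sections over `U` are the
functions on `U` which are locally fractions `a / b` of homogeneous elements with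
`deg a - deg b = n`. -/
def serreTwist {σ : Type*} {A : Type u} [CommRing A] [SetLike σ A] [AddSubgroupClass σ A]
    (𝒜 : ℕ → σ) [GradedRing 𝒜] (n : ℤ) : (Proj 𝒜).Modules where
  val := SerreTwist.presheafOfModules 𝒜 n
  isSheaf := (TopCat.Presheaf.isSheaf_iff_isSheaf_comp (forget AddCommGrpCat) _).2
    (SerreTwist.sheafInType 𝒜 n).2

namespace SerreTwist

variable {σ : Type*} {A : Type u} [CommRing A] [SetLike σ A] [AddSubgroupClass σ A]
variable (𝒜 : ℕ → σ) [GradedRing 𝒜]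

/-- For `f` of degree one and an integer `n`, the section `f ^ n` of `𝒪(n)` over `D₊(f)`. -/
def zpow {f : A} (hf : f ∈ 𝒜 1) (n : ℤ) : Γ(serreTwist 𝒜 n, Proj.basicOpen 𝒜 f) :=
  (⟨fun x => Localization.mk (f ^ n.toNat) ⟨f ^ (-n).toNat, fun h => x.2
        (Ideal.IsPrime.mem_of_pow_mem (ProjectiveSpectrum.isPrime x.1) _ h)⟩,
    fun x => ⟨_, x.2, 𝟙 _, n.toNat, (-n).toNat,
      ⟨f ^ n.toNat, by simpa using SetLike.pow_mem_graded n.toNat hf⟩,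
      ⟨f ^ (-n).toNat, by simpa using SetLike.pow_mem_graded (-n).toNat hf⟩,
      Int.toNat_sub_toNat_neg n, fun _ => ⟨_, rfl⟩⟩⟩ :
    (sheafInType 𝒜 n).obj.obj (op (ProjectiveSpectrum.basicOpen 𝒜 f)))

end SerreTwist

/-! ## Principal parts -/

namespace PrincipalParts

open Limits

variable {X S : Scheme.{u}} (f : X ⟶ S) (k : ℕ)

/-- The `k`-th infinitesimal neighbourhood `Δ^k` of the diagonal of `X / S`: the closed subscheme
of `X ×_S X` cut out by `𝓘 ^ (k + 1)`, where `𝓘` is the ideal sheaf of the diagonal. -/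
def nbhd : Scheme.{u} := ((pullback.diagonal f).ker ^ (k + 1)).subscheme

/-- The closed immersion of `Δ^k` into `X ×_S X`. -/
def incl : nbhd f k ⟶ pullback f f := ((pullback.diagonal f).ker ^ (k + 1)).subschemeι

/-- The first projection `p`, restricted to `Δ^k`. -/
def fst : nbhd f k ⟶ X := incl f k ≫ pullback.fst f f

/-- The second projection `q`, restricted to `Δ^k`. -/
def snd : nbhd f k ⟶ X := incl f k ≫ pullback.snd f f

/-- The two projections of `Δ^k` to `X` agree on underlying spaces. -/
lemma fst_apply_eq_snd_apply [IsSeparated f] (z : nbhd f k) : fst f k z = snd f k z := by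
  have h : incl f k z ∈ Set.range (incl f k) := ⟨z, rfl⟩
  have e : Set.range (incl f k) = Set.range (pullback.diagonal f) := by
    refine (Scheme.IdealSheafData.range_subschemeι _).trans ?_
    rw [Scheme.IdealSheafData.support_pow_succ, Scheme.Hom.support_ker]
    exact (pullback.diagonal f).isClosedEmbedding.isClosed_range.closure_eq
  rw [e] at h
  obtain ⟨x, hx⟩ := h
  rw [fst, snd, Scheme.Hom.comp_apply, Scheme.Hom.comp_apply, ← hx, ← Scheme.Hom.comp_apply,
    ← Scheme.Hom.comp_apply, pullback.diagonal_fst, pullback.diagonal_snd]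

lemma fst_preimage_eq [IsSeparated f] (U : X.Opens) : fst f k ⁻¹ᵁ U = snd f k ⁻¹ᵁ U := by
  ext z
  change fst f k z ∈ U ↔ snd f k z ∈ U
  rw [fst_apply_eq_snd_apply]

/-- The sheaf of principal parts `Pr^k(E) = p_* (𝒪_{Δ^k} ⊗ q^* E)` with its left module structure.
For the closed immersion `i : Δ^k ⟶ X ×_S X` one has `𝒪_{Δ^k} ⊗ G = i_* i^* G`, so this is the
pushforward along `p ∘ i` of the pullback of `E` along `q ∘ i`. -/
def left (E : X.Modules) : X.Modules :=
  (Scheme.Modules.pushforward (fst f k)).obj ((Scheme.Modules.pullback (snd f k)).obj E)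

/-- The sheaf of principal parts `Pr^k(E)` with its right module structure, where functions on `X`
act through the second projection. -/
def right (E : X.Modules) : X.Modules :=
  (Scheme.Modules.pushforward (snd f k)).obj ((Scheme.Modules.pullback (snd f k)).obj E)

/-- The left and the right structure live on the same groups of sections. -/
lemma left_eq_right [IsSeparated f] (E : X.Modules) (U : X.Opens) :
    Γ(left f k E, U) = Γ(right f k E, U) := by
  change Γ((Scheme.Modules.pullback (snd f k)).obj E, fst f k ⁻¹ᵁ U) =
    Γ((Scheme.Modules.pullback (snd f k)).obj E, snd f k ⁻¹ᵁ U)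
  rw [fst_preimage_eq]

variable {f}

/-- For a function `a` on `U`, the function `da = a ⊗ 1 - 1 ⊗ a` on the part of `Δ^k` over `U`. -/
def d [IsSeparated f] {U : X.Opens} (a : Γ(X, U)) : Γ(nbhd f k, snd f k ⁻¹ᵁ U) :=
  (fst f k).appLE U (snd f k ⁻¹ᵁ U) (fst_preimage_eq f k U).ge a - (snd f k).app U a

variable (f) in
/-- For a section `s` of `E` over `U`, the section `1 ⊗ s` of `Pr^k(E)` over `U`. -/
def oneTensor {E : X.Modules} {U : X.Opens} (s : Γ(E, U)) : Γ(right f k E, U) :=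
  ((Scheme.Modules.pullbackPushforwardAdjunction (snd f k)).unit.app E).app U s

/-- Functions on the part of `Δ^k` over `U` act on the sections of `Pr^k(E)` over `U`. -/
instance (E : X.Modules) (U : X.Opens) :
    Module Γ(nbhd f k, snd f k ⁻¹ᵁ U) Γ(right f k E, U) :=
  inferInstanceAs (Module Γ(nbhd f k, snd f k ⁻¹ᵁ U)
    Γ((Scheme.Modules.pullback (snd f k)).obj E, snd f k ⁻¹ᵁ U))

variable (f) in
/-- The section `da^p ⊗ s` of `Pr^k(E)`. -/
def dPowTensor [IsSeparated f] {E : X.Modules} {U : X.Opens} (a : Γ(X, U)) (p : ℕ) (s : Γ(E, U)) :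
    Γ(right f k E, U) :=
  d (f := f) k a ^ p • oneTensor f k s

end PrincipalParts

/-! ## The projective line over the integers -/

namespace P1

/-- The standard grading of `ℤ[x₀, x₁]`. -/
abbrev grading : ℕ → Submodule ℤ (MvPolynomial (Fin 2) ℤ) :=
  MvPolynomial.homogeneousSubmodule (Fin 2) ℤ

instance : GradedAlgebra grading := MvPolynomial.gradedAlgebra

end P1

/-- The projective line over `ℤ`, `Proj ℤ[x₀, x₁]`. -/
abbrev P1 : Scheme.{0} := Proj P1.grading

namespace P1

/-- The structure morphism of the projective line over `ℤ`. -/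
def toSpecZ : P1 ⟶ Spec (.of ℤ) := specZIsTerminal.from P1

instance : IsSeparated toSpecZ := by
  have : IsSeparated (toSpecZ ≫ Limits.terminal.from (Spec (.of ℤ))) := by
    rw [Limits.terminal.comp_from]
    infer_instance
  exact IsSeparated.of_comp _ (Limits.terminal.from (Spec (.of ℤ)))

lemma X_mem (i : Fin 2) : (MvPolynomial.X i : MvPolynomial (Fin 2) ℤ) ∈ grading 1 :=
  MvPolynomial.isHomogeneous_X _ _

/-- The standard affine open `U_i = D₊(x_i)`. -/
abbrev U (i : Fin 2) : P1.Opens := Proj.basicOpen grading (MvPolynomial.X i)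

/-- The overlap `U_0 ∩ U_1`. -/
abbrev U01 : P1.Opens := U 0 ⊓ U 1

lemma U01_le : ∀ i : Fin 2, U01 ≤ U i
  | 0 => inf_le_left
  | 1 => inf_le_right

/-- Restriction to `U_0 ∩ U_1` of a section over `U_i` of a sheaf of modules. -/
def res (M : P1.Modules) (i : Fin 2) (s : Γ(M, U i)) : Γ(M, U01) :=
  M.presheaf.map (homOfLE (U01_le i)).op s

/-- The function `x_j / x_i` on `U_i`. -/
def ratio (i j : Fin 2) : Γ(P1, U i) :=
  Proj.awayToSection grading (MvPolynomial.X i)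
    (HomogeneousLocalization.Away.mk grading (X_mem i) 1 (MvPolynomial.X j)
      (by simpa using X_mem j))

/-- The function `x_j / x_i` on `U_0 ∩ U_1`. -/
def ratio01 (i j : Fin 2) : Γ(P1, U01) :=
  P1.presheaf.map (homOfLE (U01_le i)).op (ratio i j)

lemma ratio01_val (i j : Fin 2) (x : U01) :
    (Subtype.val (p := (ProjectiveSpectrum.StructureSheaf.isLocallyFraction grading).pred)
      (ratio01 i j) x).val =
      Localization.mk (MvPolynomial.X j) ⟨MvPolynomial.X i, U01_le i x.2⟩ := by
  have := ProjectiveSpectrum.Proj.awayToSection_apply grading (MvPolynomial.X i)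
    (HomogeneousLocalization.Away.mk grading (X_mem i) 1 (MvPolynomial.X j)
      (by simpa using X_mem j)) ⟨x.1, U01_le i x.2⟩
  refine this.trans ?_
  rw [HomogeneousLocalization.Away.val_mk, Localization.mk_eq_mk', IsLocalization.map_mk',
    ← Localization.mk_eq_mk']
  refine Localization.mk_eq_mk_iff.mpr (Localization.r_of_eq ?_)
  simp

lemma ratio01_mul (i j : Fin 2) : ratio01 i j * ratio01 j i = 1 := by
  refine Subtype.ext <| funext fun x => ?_
  apply HomogeneousLocalization.val_injective
  refine (HomogeneousLocalization.val_mul _ _).trans ?_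
  refine (congrArg₂ (· * ·) (ratio01_val i j x) (ratio01_val j i x)).trans ?_
  refine (Localization.mk_mul _ _ _ _).trans (Eq.trans ?_ HomogeneousLocalization.val_one.symm)
  rw [← Localization.mk_one, Localization.mk_eq_mk_iff]
  refine Localization.r_of_eq ?_
  simp [mul_comm]

/-- The unit `u = x_1 / x_0` on `U_0 ∩ U_1`, with inverse `v = x_0 / x_1`. -/
def u : Γ(P1, U01)ˣ where
  val := ratio01 0 1
  inv := ratio01 1 0
  val_inv := ratio01_mul 0 1
  inv_val := ratio01_mul 1 0

/-- `Pr^k(𝒪(n))` on the projective line over `ℤ`, as a right module. -/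
abbrev Pr (n : ℤ) (k : ℕ) : P1.Modules :=
  PrincipalParts.right toSpecZ k (serreTwist grading n)

/-- The section `x_i^n` of `𝒪(n)` over `U_i`. -/
def xpow (i : Fin 2) (n : ℤ) : Γ(serreTwist grading n, U i) :=
  SerreTwist.zpow grading (X_mem i) n

/-- The section `1 ⊗ x_i^n` of `Pr^k(𝒪(n))` over `U_i`. -/
def one (i : Fin 2) (n : ℤ) (k : ℕ) : Γ(Pr n k, U i) :=
  PrincipalParts.oneTensor toSpecZ k (xpow i n)

/-- The section `du^p ⊗ x_0^n` of `Pr^k(𝒪(n))` over `U_0`, where `u = x_1 / x_0`. -/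
def du (n : ℤ) (k p : ℕ) : Γ(Pr n k, U 0) :=
  PrincipalParts.dPowTensor toSpecZ k (ratio 0 1) p (xpow 0 n)

/-- The section `dv^p ⊗ x_1^n` of `Pr^k(𝒪(n))` over `U_1`, where `v = x_0 / x_1`. -/
def dv (n : ℤ) (k p : ℕ) : Γ(Pr n k, U 1) :=
  PrincipalParts.dPowTensor toSpecZ k (ratio 1 0) p (xpow 1 n)

/-- The matrix `R^k_n`, whose column `p` lists the coefficients of `dv^p ⊗ x_1^n`. -/
def R (n : ℤ) (k : ℕ) : Matrix (Fin (k + 1)) (Fin (k + 1)) Γ(P1, U01) :=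
  Matrix.of fun j p =>
    if (p : ℕ) = 0 then
      if (j : ℕ) = 0 then ((u ^ n : Γ(P1, U01)ˣ) : Γ(P1, U01)) else 0
    else if (p : ℕ) ≤ j then
      (-1) ^ (j : ℕ) * (((j : ℕ) - 1).choose ((p : ℕ) - 1) : Γ(P1, U01)) *
        ((u ^ (n - (p : ℕ) - (j : ℕ)) : Γ(P1, U01)ˣ) : Γ(P1, U01))
    else 0

end P1

end

/-!
Over `U_0` put `u = x_1 / x_0`.  The ring of functions on `U_0` is `ℤ[u]`
(`P1.bijective_eval₂_ratio`), so the functions on `U_0 × U_0` form the polynomial ring over the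
second factor `ℤ[u]` in the variable `du = u ⊗ 1 - 1 ⊗ u` (`bijective_eval₂_of_isPushout`).  The
diagonal is cut out by `du`, hence the functions on `Δ^k` over `U_0` are the truncated polynomials
`ℤ[u][du] / (du ^ (k + 1))`, free over `ℤ[u]` on the powers of `du`
(`PrincipalParts.isPowerBasis_d`).  Inverting `u` gives the same over `U_0 ∩ U_1`
(`PrincipalParts.isPowerBasis_d_basicOpen`), and the case of `U_1` is symmetric.

The section `x_i ^ n` freely generates `𝒪(n)` over `U_i` (`SerreTwist.isLocalGenerator_zpow`), and a
free generator pulls back to a free generator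
(`AlgebraicGeometry.Scheme.Modules.IsLocalGenerator.pullback`).  The latter is proved from the
universal property of the pullback: with `j` the inclusion of the preimage `V` of `U`, the morphisms
from `M` to `f_* j_* N` are the sections of `N` over `V`.  So `1 ⊗ x_i ^ n` freely generates the
principal parts as a module over the functions on `Δ^k`, and multiplying the power basis by it gives
the bases `D` and `D'`.

On the overlap `x_1 ^ n = u ^ n * x_0 ^ n`.  Since `x_0 / x_1 ⊗ 1` is the inverse of
`x_1 / x_0 ⊗ 1 = u + du`, one finds `dv = 1 / (u + du) - 1 / u = -du / (u * (u + du))`, and the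
binomial series, finite because `du` is nilpotent, gives the entries of the transition matrix
(`sub_inv_pow_eq_sum`).
-/

/-! ### Power bases, and powers of an inverse -/

section

open Polynomial

/-- The family `1, d, …, d ^ (m - 1)` is a basis of `C`, viewed as an `R`-module through `g`. -/
def IsPowerBasis {R C : Type*} [CommRing R] [CommRing C] (g : R →+* C) (d : C) (m : ℕ) : Prop :=
  Function.Bijective fun c : Fin m → R => ∑ j, g (c j) * d ^ (j : ℕ)

/-- If `R[X] → C`, `X ↦ d`, is surjective with kernel `(X ^ m)`, then every class has a unique
representative of degree less than `m`, so the powers of `d` form a basis. -/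
theorem isPowerBasis_of_eval₂ {R C : Type*} [CommRing R] [CommRing C] (g : R →+* C) (d : C) (m : ℕ)
    (hs : Function.Surjective (eval₂RingHom g d))
    (hk : RingHom.ker (eval₂RingHom g d) = Ideal.span {(X : R[X]) ^ m}) :
    IsPowerBasis g d m := by
  have key (c : Fin m → R) : ∑ j, g (c j) * d ^ (j : ℕ) =
      eval₂RingHom g d (∑ j, Polynomial.C (c j) * X ^ (j : ℕ)) := by
    rw [map_sum]
    exact Finset.sum_congr rfl fun j _ => by simp
  have hcoeff (c : Fin m → R) (i : Fin m) :
      (∑ j, Polynomial.C (c j) * X ^ (j : ℕ) : R[X]).coeff i = c i := by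
    rw [finsetSum_coeff, Finset.sum_eq_single i]
    · simp
    · intro j _ hj
      simp [coeff_X_pow, Fin.val_inj, hj.symm]
    · simp
  have hker (P : R[X]) : eval₂RingHom g d P = 0 ↔ ∀ i < m, P.coeff i = 0 := by
    rw [← RingHom.mem_ker, hk, Ideal.mem_span_singleton, X_pow_dvd_iff]
  constructor
  · intro c c' h
    simp only [key] at h
    rw [← sub_eq_zero, ← map_sub, hker] at h
    ext i
    have := h i i.2
    rwa [coeff_sub, hcoeff, hcoeff, sub_eq_zero] at this
  · intro y
    obtain ⟨P, rfl⟩ := hs y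
    refine ⟨fun j => P.coeff j, ?_⟩
    simp only [key]
    rw [← sub_eq_zero, ← map_sub, hker]
    intro i hi
    rw [coeff_sub, hcoeff _ ⟨i, hi⟩, sub_self]

/-- Power bases survive inverting an element `a` of `R` in both rings. -/
theorem IsPowerBasis.away {R C R' C' : Type*} [CommRing R] [CommRing C] [CommRing R'] [CommRing C']
    {g : R →+* C} {d : C} {m : ℕ} (h : IsPowerBasis g d m) (a : R) (ρ : R →+* R') (ρ' : C →+* C')
    (g' : R' →+* C') (hcomm : g'.comp ρ = ρ'.comp g)
    (hρ : letI := ρ.toAlgebra; IsLocalization.Away a R')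
    (hρ' : letI := ρ'.toAlgebra; IsLocalization.Away (g a) C') :
    IsPowerBasis g' (ρ' d) m := by
  let : Algebra R C := g.toAlgebra
  let : Algebra R R' := ρ.toAlgebra
  let : Algebra C C' := ρ'.toAlgebra
  let : Algebra R' C' := g'.toAlgebra
  let : Algebra R C' := (ρ'.comp g).toAlgebra
  have : IsScalarTower R C C' := .of_algebraMap_eq' rfl
  have : IsScalarTower R R' C' := .of_algebraMap_eq' hcomm.symm
  let φ : (Fin m → R) →ₗ[R] C := Fintype.linearCombination R fun j : Fin m => d ^ (j : ℕ)
  have hφ : Function.Bijective φ := h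
  let b : Module.Basis (Fin m) R C := .ofEquivFun (LinearEquiv.ofBijective φ hφ).symm
  have : IsLocalization (Algebra.algebraMapSubmonoid C (Submonoid.powers a)) C' := by
    rw [Algebra.algebraMapSubmonoid, Submonoid.map_powers]
    exact hρ'
  let b' := b.ofIsLocalizedModule R' (Submonoid.powers a)
    (IsScalarTower.toAlgHom R C C').toLinearMap
  have hb (j) : b j = d ^ (j : ℕ) := by
    simp [b, φ, Fintype.linearCombination_apply, Pi.single_apply]
  have hb' (j) : b' j = ρ' d ^ (j : ℕ) := by
    refine (b.ofIsLocalizedModule_apply R' (Submonoid.powers a) _ j).trans ?_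
    rw [hb, ← map_pow]
    rfl
  have : (fun c : Fin m → R' => ∑ j, g' (c j) * ρ' d ^ (j : ℕ)) = b'.equivFun.symm := by
    ext c
    simp only [Module.Basis.equivFun_symm_apply, hb']
    rfl
  rw [IsPowerBasis, this]
  exact b'.equivFun.symm.bijective

/-- If `R` is the polynomial ring `ℤ[a]`, then the coproduct `R ⊗ R` is the polynomial ring over its
second factor in the variable `a ⊗ 1 - 1 ⊗ a`. -/
theorem bijective_eval₂_of_isPushout {S R B : CommRingCat.{0}} {f : S ⟶ R} {inl inr : R ⟶ B}
    (h : IsPushout f f inl inr) (e : Function.Bijective (Int.castRingHom S))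
    (a : R) (ha : Function.Bijective (eval₂RingHom (Int.castRingHom R) a)) :
    Function.Bijective (eval₂RingHom inr.hom (inl.hom a - inr.hom a)) := by
  let E := RingEquiv.ofBijective _ ha
  have hS {T : Type} [CommRing T] (g₁ g₂ : S →+* T) : g₁ = g₂ := by
    refine RingHom.ext fun x => ?_
    obtain ⟨x, rfl⟩ := e.2 x
    simp
  have hR {T : Type} [CommRing T] {g₁ g₂ : R →+* T} (h : g₁ a = g₂ a) : g₁ = g₂ := by
    have : g₁.comp (eval₂RingHom (Int.castRingHom R) a) =
        g₂.comp (eval₂RingHom (Int.castRingHom R) a) := by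
      refine Polynomial.ringHom_ext (fun r => by simp) ?_
      simpa using h
    exact RingHom.ext fun x => by obtain ⟨x, rfl⟩ := ha.2 x; exact congr($this x)
  -- The inverse is given on the second factor by constants and on the first by `a ↦ X + a`.
  let l : R →+* R[X] :=
    (eval₂RingHom (Int.castRingHom R[X]) (X + Polynomial.C a)).comp E.symm.toRingHom
  have hl : l a = X + Polynomial.C a := by
    have : E.symm a = X := by rw [RingEquiv.symm_apply_eq]; simp [E]
    simp [l, this]
  let ψ : B ⟶ .of R[X] := h.desc (CommRingCat.ofHom l) (CommRingCat.ofHom Polynomial.C)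
    (CommRingCat.hom_ext (hS _ _))
  have h₁ (x) : ψ (inl x) = l x := congr($(h.inl_desc _ _ _) x)
  have h₂ (x) : ψ (inr x) = Polynomial.C x := congr($(h.inr_desc _ _ _) x)
  refine Function.bijective_iff_has_inverse.2 ⟨ψ, fun P => ?_, fun b => ?_⟩
  · have : ψ.hom.comp (eval₂RingHom inr.hom (inl.hom a - inr.hom a)) = RingHom.id _ := by
      refine Polynomial.ringHom_ext (fun r => ?_) ?_
      · simpa using h₂ r
      · have : ψ.hom (inl.hom a - inr.hom a) = X := by
          rw [map_sub]
          refine (congr($((h₁ a).trans hl) - $(h₂ a))).trans ?_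
          rw [add_sub_cancel_right]
        simpa using this
    exact congr($this P)
  · have : ψ ≫ CommRingCat.ofHom (eval₂RingHom inr.hom (inl.hom a - inr.hom a)) = 𝟙 B := by
      apply h.hom_ext
      · refine CommRingCat.hom_ext (hR ?_)
        simpa [hl] using congr(eval₂ inr.hom (inl.hom a - inr.hom a) $(h₁ a))
      · ext r
        simpa using congr(eval₂ inr.hom (inl.hom a - inr.hom a) $(h₂ r))
    exact congr($this b)

/-- Truncated form of the identity `(1 + w) f_{p+1} = -w f_p`, where `f_p` is the power series
`∑ i, (-1) ^ (i + 1) * i.choose p * w ^ (i + 1)`; the right-hand side is the truncation error. -/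
theorem one_add_mul_sum_choose {C : Type*} [CommRing C] (w : C) (k p : ℕ) :
    (1 + w) * (∑ i ∈ Finset.range k, (-1) ^ (i + 1) * (i.choose (p + 1) : C) * w ^ (i + 1)) +
      w * (∑ i ∈ Finset.range k, (-1) ^ (i + 1) * (i.choose p : C) * w ^ (i + 1)) =
    (-1) ^ k * (k.choose (p + 1) : C) * w ^ (k + 1) := by
  induction k with
  | zero => simp
  | succ k ih =>
    rw [Finset.sum_range_succ, Finset.sum_range_succ, Nat.choose_succ_succ]
    push_cast
    linear_combination ih

/-- The case `f_{-1} = 1` of `one_add_mul_sum_choose`: a truncated geometric series. -/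
theorem one_add_mul_sum_neg_one {C : Type*} [CommRing C] (w : C) (k : ℕ) :
    (1 + w) * (∑ i ∈ Finset.range k, (-1) ^ (i + 1) * w ^ (i + 1)) + w =
    (-1) ^ k * w ^ (k + 1) := by
  induction k with
  | zero => simp
  | succ k ih =>
    rw [Finset.sum_range_succ]
    linear_combination ih

/-- The binomial expansion of `(-w / (1 + w)) ^ (p + 1)` for nilpotent `w`. -/
theorem sub_one_pow_eq_sum {C : Type*} [CommRing C] {w y : C} {k : ℕ} (hw : w ^ (k + 1) = 0)
    (hy : (1 + w) * y = 1) (p : ℕ) :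
    (y - 1) ^ (p + 1) =
      ∑ i ∈ Finset.range k, (-1) ^ (i + 1) * (i.choose p : C) * w ^ (i + 1) := by
  have hy' : y - 1 = -w * y := by linear_combination hy
  induction p with
  | zero =>
    have := one_add_mul_sum_neg_one w k
    rw [hw] at this
    simp only [Nat.choose_zero_right, Nat.cast_one, mul_one]
    linear_combination hy' - y * this + hy *
      (∑ i ∈ Finset.range k, (-1) ^ (i + 1) * w ^ (i + 1))
  | succ p ih =>
    have := one_add_mul_sum_choose w k p
    rw [hw] at this
    rw [pow_succ, ih]
    linear_combination (∑ i ∈ Finset.range k, (-1) ^ (i + 1) * (i.choose p : C) * w ^ (i + 1)) * hy'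
      - y * this + hy *
      (∑ i ∈ Finset.range k, (-1) ^ (i + 1) * (i.choose (p + 1) : C) * w ^ (i + 1))

/-- If `v` is the inverse of `u + δ` with `δ` nilpotent, this expands the powers of
`v - 1 / u = -δ / (u * (u + δ))` in powers of `δ`. -/
theorem sub_inv_pow_eq_sum {C : Type*} [CommRing C] (u : Cˣ) (δ v : C) (k : ℕ)
    (hδ : δ ^ (k + 1) = 0)
    (hv : (u + δ) * v = 1) (p : ℕ) (hp : 1 ≤ p) :
    (v - (u⁻¹ : Cˣ)) ^ p = ∑ j ∈ Finset.Icc p k,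
      (-1) ^ j * ((j - 1).choose (p - 1) : C) * ((u ^ (-(p : ℤ) - j) : Cˣ) : C) * δ ^ j := by
  obtain ⟨p, rfl⟩ := Nat.exists_eq_add_of_le' hp
  have huu : (u : C) * (u⁻¹ : Cˣ) = 1 := u.mul_inv
  have h₁ : ((u⁻¹ : Cˣ) * δ) ^ (k + 1) = 0 := by rw [mul_pow, hδ, mul_zero]
  have h₂ : (1 + (u⁻¹ : Cˣ) * δ) * (u * v) = 1 := by linear_combination hv + δ * v * huu
  -- Rescaling by `u` reduces to `w = δ / u` and `y = u v = 1 / (1 + w)`.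
  have h₃ : v - (u⁻¹ : Cˣ) = (u⁻¹ : Cˣ) * (u * v - 1) := by linear_combination -v * huu
  rw [h₃, mul_pow, sub_one_pow_eq_sum h₁ h₂, Finset.mul_sum, Finset.range_eq_Ico]
  refine (Finset.sum_Ico_add' (fun j => (u⁻¹ : Cˣ) ^ (p + 1) * ((-1) ^ j * ((j - 1).choose p : C) *
      ((u⁻¹ : Cˣ) * δ) ^ j)) 0 k 1).trans ?_
  -- The terms with `1 ≤ j < p` vanish because their binomial coefficients do.
  refine Eq.symm ((Finset.sum_subset_zero_on_sdiff ?_ ?_ ?_))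
  · intro j
    simp only [Finset.mem_Icc, Finset.mem_Ico]
    omega
  · intro j hj
    simp only [Finset.mem_sdiff, Finset.mem_Icc, Finset.mem_Ico] at hj
    rw [Nat.choose_eq_zero_of_lt (by omega)]
    simp
  · intro j hj
    have : u ^ (-((p + 1 : ℕ) : ℤ) - j) = u⁻¹ ^ (p + 1) * u⁻¹ ^ j := by
      rw [← pow_add, inv_pow, ← zpow_natCast, ← zpow_neg]
      congr 1
      push_cast
      ring
    rw [this, mul_pow, Nat.add_sub_cancel]
    push_cast
    ring

end

/-! ### Free generators of sheaves of modules and their pullbacks -/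

namespace AlgebraicGeometry.Scheme.Modules

noncomputable section

/-- A morphism of sheaves of modules from a compatible family of linear maps on sections. -/
def homOfSections {X : Scheme.{u}} {M N : X.Modules} (φ : ∀ U : X.Opens, Γ(M, U) →+ Γ(N, U))
    (hsmul : ∀ U (r : Γ(X, U)) (m : Γ(M, U)), φ U (r • m) = r • φ U m)
    (hmap : ∀ U V (i : U ⟶ V) (m : Γ(M, V)),
      φ U (M.presheaf.map i.op m) = N.presheaf.map i.op (φ V m)) : M ⟶ N :=
  SheafOfModules.Hom.mk (PresheafOfModules.homMk
    { app U := AddCommGrpCat.ofHom (φ U.unop)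
      naturality U V i := by
        ext m
        exact hmap _ _ i.unop m }
    (fun U r m => hsmul U.unop r m))

theorem homOfSections_app {X : Scheme.{u}} {M N : X.Modules} (φ : ∀ U : X.Opens, Γ(M, U) →+ Γ(N, U))
    (hsmul) (hmap) (U) (m : Γ(M, U)) : (homOfSections φ hsmul hmap).app U m = φ U m := rfl

/-- Over `U`, the sheaf of modules `M` is free of rank one on the section `e`. -/
def IsLocalGenerator {X : Scheme.{u}} (M : X.Modules) {U : X.Opens} (e : Γ(M, U)) : Prop :=
  ∀ (W : X.Opens) (h : W ≤ U), Function.Bijective fun a : Γ(X, W) =>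
    a • M.presheaf.map (homOfLE h).op e

/-- `N` is the pushforward of its restriction to `U`. -/
def IsSupportedOver {X : Scheme.{u}} (N : X.Modules) (U : X.Opens) : Prop :=
  ∀ W : X.Opens, Function.Bijective (N.presheaf.map (homOfLE (inf_le_left : W ⊓ U ≤ W)).op)

theorem map_app {X : Scheme.{u}} {M N : X.Modules} (φ : M ⟶ N) {U V : X.Opens} (i : U ⟶ V)
    (m : Γ(M, V)) : φ.app U (M.presheaf.map i.op m) = N.presheaf.map i.op (φ.app V m) :=
  congr($(φ.mapPresheaf.naturality i.op) m)

theorem map_map {X : Scheme.{u}} (M : X.Modules) {U V W : X.Opens} (i : U ⟶ V) (j : V ⟶ W)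
    (k : U ⟶ W) (m : Γ(M, W)) :
    M.presheaf.map i.op (M.presheaf.map j.op m) = M.presheaf.map k.op m := by
  rw [← CategoryTheory.comp_apply, ← Functor.map_comp]
  rfl

variable {X Z : Scheme.{u}} {M N : X.Modules} {U : X.Opens} {e : Γ(M, U)}

/-- A morphism to a module supported over `U` is determined by its value on a generator over `U`. -/
theorem IsLocalGenerator.hom_ext (he : IsLocalGenerator M e) (hN : IsSupportedOver N U)
    {φ ψ : M ⟶ N} (h : φ.app U e = ψ.app U e) : φ = ψ := by
  ext W m
  apply (hN W).1
  rw [← map_app, ← map_app]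
  obtain ⟨a, ha⟩ := (he (W ⊓ U) inf_le_right).2 (M.presheaf.map (homOfLE inf_le_left).op m)
  rw [← ha]
  simp only [Hom.app_smul, map_app, h]

/-- A section `n` of `N` over `U` defines a morphism `M ⟶ N`: over `W`, write a section of `M`,
restricted to `W ⊓ U`, as `a • e`, and take the section of `N` that restricts to `a • n`. -/
theorem IsLocalGenerator.exists_hom (he : IsLocalGenerator M e) (hN : IsSupportedOver N U)
    (n : Γ(N, U)) : ∃ φ : M ⟶ N, φ.app U e = n := by
  -- `c W m` is the coefficient of `m` on `W ⊓ U`, and `f W m` the section of `N` that it yields.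
  let A (W : X.Opens) : Γ(X, W ⊓ U) ≃ Γ(M, W ⊓ U) := Equiv.ofBijective _ (he (W ⊓ U) inf_le_right)
  let B (W : X.Opens) : Γ(N, W) ≃ Γ(N, W ⊓ U) := Equiv.ofBijective _ (hN W)
  let c (W : X.Opens) (m : Γ(M, W)) : Γ(X, W ⊓ U) :=
    (A W).symm (M.presheaf.map (homOfLE inf_le_left).op m)
  have hc (W m) : c W m • M.presheaf.map (homOfLE inf_le_right).op e =
      M.presheaf.map (homOfLE inf_le_left).op m := (A W).apply_symm_apply _
  have hc' (W m) (a : Γ(X, W ⊓ U)) (h : a • M.presheaf.map (homOfLE inf_le_right).op e =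
      M.presheaf.map (homOfLE inf_le_left).op m) : c W m = a :=
    (A W).symm_apply_eq.2 h.symm
  let f (W : X.Opens) (m : Γ(M, W)) : Γ(N, W) :=
    (B W).symm (c W m • N.presheaf.map (homOfLE inf_le_right).op n)
  have hf (W m) : N.presheaf.map (homOfLE inf_le_left).op (f W m) =
      c W m • N.presheaf.map (homOfLE inf_le_right).op n := (B W).apply_symm_apply _
  have hf' (W m x) (h : N.presheaf.map (homOfLE inf_le_left).op x =
      c W m • N.presheaf.map (homOfLE inf_le_right).op n) : f W m = x :=
    (B W).symm_apply_eq.2 h.symm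
  refine ⟨homOfSections (fun W => AddMonoidHom.mk' (f W) fun m m' => hf' _ _ _ ?_)
    (fun W r m => hf' _ _ _ ?_) (fun W W' i m => hf' _ _ _ ?_), ?_⟩
  · rw [map_add, hf, hf, ← add_smul]
    congr 1
    refine (hc' _ _ _ ?_).symm
    rw [add_smul, hc, hc, map_add]
  · simp only [AddMonoidHom.mk'_apply, map_smul, hf, smul_smul]
    congr 1
    refine (hc' _ _ _ ?_).symm
    rw [mul_smul, hc, map_smul]
  · have h₁ := congr(N.presheaf.map (homOfLE (inf_le_inf_right U (leOfHom i))).op $(hf W' m))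
    rw [map_smul, map_map N _ _ (homOfLE (inf_le_left.trans (leOfHom i))),
      map_map N _ _ (homOfLE inf_le_right)] at h₁
    simp only [AddMonoidHom.mk'_apply]
    rw [map_map N _ _ (homOfLE (inf_le_left.trans (leOfHom i))), h₁]
    congr 1
    refine (hc' _ _ _ ?_).symm
    have h₂ := congr(M.presheaf.map (homOfLE (inf_le_inf_right U (leOfHom i))).op $(hc W' m))
    rw [map_smul, map_map M _ _ (homOfLE (inf_le_left.trans (leOfHom i))),
      map_map M _ _ (homOfLE inf_le_right)] at h₂
    rw [h₂, map_map M _ _ (homOfLE (inf_le_left.trans (leOfHom i)))]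
  · refine (homOfSections_app _ _ _ _ _).trans (hf' _ _ _ ?_)
    have : c U e = 1 := hc' _ _ _ (one_smul _ _)
    rw [this, one_smul]

theorem bijective_map_of_eq (M : X.Modules) {U V : X.Opens} (i : U ⟶ V) (h : U = V) :
    Function.Bijective (M.presheaf.map i.op) := by
  subst h
  obtain rfl : i = 𝟙 _ := Subsingleton.elim _ _
  rw [op_id, CategoryTheory.Functor.map_id]
  exact Function.bijective_id

/-- The pushforward to `Z` of the restriction of `G` to the open `V`. -/
def extend (G : Z.Modules) (V : Z.Opens) : Z.Modules := (pushforward V.ι).obj (G.restrict V.ι)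

/-- The restriction map from `G` to the pushforward of its restriction to `V`. -/
def toExtend (G : Z.Modules) (V : Z.Opens) : G ⟶ extend G V :=
  (restrictAdjunction V.ι).unit.app G

theorem toExtend_app (G : Z.Modules) (V W : Z.Opens) (m : Γ(G, W)) :
    (toExtend G V).app W m = G.presheaf.map (homOfLE (V.ι.image_preimage_le W)).op m := rfl

theorem toExtend_app_bijective (G : Z.Modules) {V W : Z.Opens} (h : W ≤ V) :
    Function.Bijective ((toExtend G V).app W) :=
  bijective_map_of_eq G (homOfLE (V.ι.image_preimage_le W)) (by
    rw [Scheme.Hom.image_preimage_eq_opensRange_inf, Scheme.Opens.opensRange_ι]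
    exact inf_eq_right.2 h)

theorem isSupportedOver_pushforward_extend (f : Z ⟶ X) (G : Z.Modules) (U : X.Opens) :
    IsSupportedOver ((pushforward f).obj (extend G (f ⁻¹ᵁ U))) U := by
  intro W
  have h : (f ⁻¹ᵁ U).ι ''ᵁ ((f ⁻¹ᵁ U).ι ⁻¹ᵁ (f ⁻¹ᵁ (W ⊓ U))) =
      (f ⁻¹ᵁ U).ι ''ᵁ ((f ⁻¹ᵁ U).ι ⁻¹ᵁ (f ⁻¹ᵁ W)) := by
    simp only [Scheme.Hom.image_preimage_eq_opensRange_inf, Scheme.Opens.opensRange_ι]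
    ext x
    change x ∈ f ⁻¹ᵁ U ∧ x ∈ f ⁻¹ᵁ W ∧ x ∈ f ⁻¹ᵁ U ↔ x ∈ f ⁻¹ᵁ U ∧ x ∈ f ⁻¹ᵁ W
    tauto
  exact bijective_map_of_eq G (homOfLE h.le) h

/-- The structure sheaf, viewed as a sheaf of modules. -/
def unitModule (Z : Scheme.{u}) : Z.Modules := SheafOfModules.unit Z.ringCatSheaf

/-- The section `1` of the structure sheaf, viewed as a sheaf of modules. -/
def unitOne (Z : Scheme.{u}) (W : Z.Opens) :
    Γ((unitModule Z), W) := (1 : Γ(Z, W))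

theorem smul_unitOne_bijective (Z : Scheme.{u}) (W : Z.Opens) :
    Function.Bijective fun a : Γ(Z, W) => a • unitOne Z W := by
  have : (fun a : Γ(Z, W) => a • unitOne Z W) = fun a => a :=
    funext fun a => mul_one (a : Γ(Z, W))
  rw [this]
  exact Function.bijective_id

theorem map_unitOne (Z : Scheme.{u}) {V W : Z.Opens} (i : V ⟶ W) :
    (unitModule Z).presheaf.map i.op (unitOne Z W) =
      unitOne Z V :=
  map_one (Z.presheaf.map i.op).hom

/-- Over `V`, the map `a ↦ a • e` from the structure sheaf to `G` given by a section `e`. -/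
def restrictUnitHom (G : Z.Modules) {V : Z.Opens} (e : Γ(G, V)) :
    (unitModule Z).restrict V.ι ⟶ G.restrict V.ι :=
  homOfSections (M := (unitModule Z).restrict V.ι)
    (N := G.restrict V.ι)
    (fun W => AddMonoidHom.mk' (fun a : Γ(Z, V.ι ''ᵁ W) =>
      (a • G.presheaf.map (homOfLE (V.ι_image_le W)).op e : Γ(G, V.ι ''ᵁ W)))
      fun (a b : Γ(Z, V.ι ''ᵁ W)) => add_smul a b (G.presheaf.map (homOfLE (V.ι_image_le W)).op e))
    (fun W r m => mul_smul ((V.ι.appIso W).inv r) (m : Γ(Z, V.ι ''ᵁ W))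
      (G.presheaf.map (homOfLE (V.ι_image_le W)).op e))
    (fun W W' i m => by
      refine Eq.trans ?_ (map_smul G (V.ι.opensFunctor.map i) (m : Γ(Z, V.ι ''ᵁ W')) _).symm
      rw [map_map G _ _ (homOfLE (V.ι_image_le W))]
      rfl)

/-- The extension of `a ↦ a • e` sends `1` to `e`. -/
theorem extend_restrictUnitHom (G : Z.Modules) {V : Z.Opens} (e : Γ(G, V)) {W : Z.Opens}
    (h : W ≤ V) : ((pushforward V.ι).map (restrictUnitHom G e)).app W
      ((toExtend _ V).app W (unitOne Z W)) =
        (toExtend G V).app W (G.presheaf.map (homOfLE h).op e) := by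
  have h₁ : (toExtend _ V).app W (unitOne Z W) = unitOne Z (V.ι ''ᵁ (V.ι ⁻¹ᵁ W)) :=
    map_unitOne Z _
  rw [h₁, toExtend_app, map_map G _ _ (homOfLE (V.ι_image_le _))]
  let x : Γ(G, V.ι ''ᵁ (V.ι ⁻¹ᵁ W)) := G.presheaf.map (homOfLE (V.ι_image_le _)).op e
  exact one_smul Γ(Z, V.ι ''ᵁ (V.ι ⁻¹ᵁ W)) x

/-- The pullback of a module that is free of rank one on `e` over `U` is free of rank one on the
pullback of `e` over the preimage of `U`. -/
theorem IsLocalGenerator.pullback (he : IsLocalGenerator M e) (f : Z ⟶ X) :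
    IsLocalGenerator (U := f ⁻¹ᵁ U) ((pullback f).obj M)
      (((pullbackPushforwardAdjunction f).unit.app M).app U e) := by
  set G := (Modules.pullback f).obj M
  set V := f ⁻¹ᵁ U
  set adj := pullbackPushforwardAdjunction f
  let e' : Γ(G, V) := (adj.unit.app M).app U e
  let O := unitModule Z
  -- By adjunction, `e ↦ 1` defines `β` from the pullback to the structure sheaf, both over `V`.
  -- It is inverse to `γ`, given by `1 ↦ e'`.
  obtain ⟨Φ, hΦ⟩ := he.exists_hom (isSupportedOver_pushforward_extend f O U)
    ((toExtend O V).app V (unitOne Z V))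
  let β : G ⟶ extend O V := (adj.homEquiv _ _).symm Φ
  have hβΦ : adj.unit.app M ≫ (pushforward f).map β = Φ := by
    exact (adj.homEquiv_unit (f := β)).symm.trans ((adj.homEquiv _ _).apply_symm_apply Φ)
  have hβ : β.app V e' = (toExtend O V).app V (unitOne Z V) := by
    rw [← hΦ, ← hβΦ]
    rfl
  have hβW {W} (h : W ≤ V) : β.app W (G.presheaf.map (homOfLE h).op e') =
      (toExtend O V).app W (unitOne Z W) := by
    rw [map_app, hβ, ← map_app, map_unitOne]
  let γ : extend O V ⟶ extend G V := (pushforward V.ι).map (restrictUnitHom G e')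
  have hβγ : β ≫ γ = toExtend G V := by
    apply (adj.homEquiv _ _).injective
    refine he.hom_ext (isSupportedOver_pushforward_extend f G U) ?_
    simp only [Adjunction.homEquiv_unit]
    change γ.app V (β.app V e') = (toExtend G V).app V e'
    rw [hβ]
    refine (extend_restrictUnitHom G e' le_rfl).trans ?_
    congr 1
    exact congr($(G.presheaf.map_id _) e')
  intro W h
  constructor
  · intro a b hab
    apply (smul_unitOne_bijective Z W).1
    apply (toExtend_app_bijective O h).1
    have := congr(β.app W $hab)
    simp only [Hom.app_smul] at this ⊢
    rwa [hβW h] at this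
  · intro g
    obtain ⟨x, hx⟩ := (toExtend_app_bijective O h).2 (β.app W g)
    obtain ⟨a, rfl⟩ := (smul_unitOne_bijective Z W).2 x
    refine ⟨a, (toExtend_app_bijective G h).1 ?_⟩
    have h₁ : (toExtend G V).app W g = γ.app W (β.app W g) := by rw [← hβγ]; rfl
    rw [h₁, ← hx]
    simp only [Hom.app_smul]
    congr 1
    exact (extend_restrictUnitHom G e' h).symm

end
end AlgebraicGeometry.Scheme.Modules

/-! ### The generator `f ^ n` of `𝒪(n)` over `D₊(f)` -/

noncomputable section
namespace SerreTwist

variable {σ : Type*} {A : Type u} [CommRing A] [SetLike σ A] [AddSubgroupClass σ A]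
variable (𝒜 : ℕ → σ) [GradedRing 𝒜] {n : ℤ}

/-- The value of a section of `𝒪(n)` at a point. -/
def value {W : (Proj 𝒜).Opens} (s : Γ(serreTwist 𝒜 n, W)) (x : W) : Loc 𝒜 x.1 :=
  Subtype.val (p := (isLocallyFraction 𝒜 n).pred) s x

/-- The value of a function on `Proj` at a point. -/
def functionValue {W : (Proj 𝒜).Opens} (a : Γ(Proj 𝒜, W)) (x : W) : Loc 𝒜 x.1 :=
  (Subtype.val (p := (ProjectiveSpectrum.StructureSheaf.isLocallyFraction 𝒜).pred) a x).val

variable {𝒜}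

theorem value_injective {W : (Proj 𝒜).Opens} :
    Function.Injective (value 𝒜 (n := n) (W := W)) := fun _ _ h => Subtype.ext h

theorem functionValue_injective {W : (Proj 𝒜).Opens} :
    Function.Injective (functionValue 𝒜 (W := W)) := fun _ _ h =>
  Subtype.ext <| funext fun x => HomogeneousLocalization.val_injective _ (congrFun h x)

theorem value_smul {W : (Proj 𝒜).Opens} (a : Γ(Proj 𝒜, W)) (s : Γ(serreTwist 𝒜 n, W)) (x : W) :
    value 𝒜 (a • s) x = functionValue 𝒜 a x * value 𝒜 s x := rfl

theorem functionValue_one {W : (Proj 𝒜).Opens} (x : W) :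
    functionValue 𝒜 (1 : Γ(Proj 𝒜, W)) x = 1 :=
  HomogeneousLocalization.val_one

theorem functionValue_mul {W : (Proj 𝒜).Opens} (a b : Γ(Proj 𝒜, W)) (x : W) :
    functionValue 𝒜 (a * b) x = functionValue 𝒜 a x * functionValue 𝒜 b x :=
  HomogeneousLocalization.val_mul _ _

/-- The element `f ^ n` of the localization at a homogeneous prime not containing `f`. -/
def zpowAt (x : ProjectiveSpectrum 𝒜) {f : A} (hf : f ∉ x.asHomogeneousIdeal.toIdeal) (n : ℤ) :
    Loc 𝒜 x :=
  Localization.mk (f ^ n.toNat) ⟨f ^ (-n).toNat, fun h => hf (x.isPrime.mem_of_pow_mem _ h)⟩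

/-- An element `f` outside a homogeneous prime, as a unit of the localization there. -/
def unitAt (x : ProjectiveSpectrum 𝒜) {f : A} (hf : f ∉ x.asHomogeneousIdeal.toIdeal) :
    (Loc 𝒜 x)ˣ where
  val := Localization.mk f 1
  inv := Localization.mk 1 ⟨f, hf⟩
  val_inv := by
    rw [Localization.mk_mul, ← Localization.mk_one, Localization.mk_eq_mk_iff]
    exact Localization.r_of_eq (by simp)
  inv_val := by
    rw [Localization.mk_mul, ← Localization.mk_one, Localization.mk_eq_mk_iff]
    exact Localization.r_of_eq (by simp)

theorem zpowAt_eq (x : ProjectiveSpectrum 𝒜) {f : A}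
    (hf : f ∉ x.asHomogeneousIdeal.toIdeal) (n : ℤ) :
    zpowAt x hf n = ((unitAt x hf ^ n : (Loc 𝒜 x)ˣ) : Loc 𝒜 x) := by
  obtain ⟨m, rfl | rfl⟩ := n.eq_nat_or_neg
  · rw [zpow_natCast, Units.val_pow_eq_pow_val, unitAt, Localization.mk_pow, zpowAt,
      Localization.mk_eq_mk_iff]
    exact Localization.r_of_eq (by simp)
  · rw [zpow_neg, zpow_natCast, ← inv_pow, Units.val_pow_eq_pow_val, unitAt, Units.inv_mk,
      Localization.mk_pow, zpowAt, Localization.mk_eq_mk_iff]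
    exact Localization.r_of_eq (by simp)

theorem zpowAt_neg_mul (x : ProjectiveSpectrum 𝒜) {f : A}
    (hf : f ∉ x.asHomogeneousIdeal.toIdeal) (n : ℤ) : zpowAt x hf (-n) * zpowAt x hf n = 1 := by
  rw [zpowAt_eq, zpowAt_eq, ← Units.val_mul, ← zpow_add, neg_add_cancel, zpow_zero, Units.val_one]

/-- The value of a function at a point, as a multiplicative map. -/
def functionValueHom {W : (Proj 𝒜).Opens} (x : W) : Γ(Proj 𝒜, W) →* Loc 𝒜 x.1 where
  toFun a := functionValue 𝒜 a x
  map_one' := functionValue_one x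
  map_mul' a b := functionValue_mul a b x

theorem notMem_of_isUnit_mk (x : ProjectiveSpectrum 𝒜) {a b : A}
    (hb : b ∉ x.asHomogeneousIdeal.toIdeal) (h : IsUnit (Localization.mk a ⟨b, hb⟩ : Loc 𝒜 x)) :
    a ∉ x.asHomogeneousIdeal.toIdeal := by
  rw [Localization.mk_eq_mk'] at h
  exact (IsLocalization.AtPrime.isUnit_mk'_iff _ _ _ _).1 h

/-- The homogeneous fraction `a / b` of degree zero at a homogeneous prime not containing `b`. -/
def fracAt (x : ProjectiveSpectrum 𝒜) {i : ℕ} (a b : 𝒜 i)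
    (hb : (b : A) ∉ x.asHomogeneousIdeal.toIdeal) :
    HomogeneousLocalization.AtPrime 𝒜 x.asHomogeneousIdeal.toIdeal :=
  HomogeneousLocalization.mk ⟨i, a, b, hb⟩

theorem fracAt_val (x : ProjectiveSpectrum 𝒜) {i : ℕ} (a b : 𝒜 i)
    (hb : (b : A) ∉ x.asHomogeneousIdeal.toIdeal) :
    (fracAt x a b hb).val = Localization.mk (a : A) ⟨b, hb⟩ :=
  HomogeneousLocalization.val_mk _

theorem mk_mul_zpowAt_neg (x : ProjectiveSpectrum 𝒜) {f : A}
    (hf : f ∉ x.asHomogeneousIdeal.toIdeal) (n : ℤ) (a b : A)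
    (hb : b ∉ x.asHomogeneousIdeal.toIdeal)
    (hb' : b * f ^ n.toNat ∉ x.asHomogeneousIdeal.toIdeal) :
    (Localization.mk a ⟨b, hb⟩ : Loc 𝒜 x) * zpowAt x hf (-n) =
      Localization.mk (a * f ^ (-n).toNat) ⟨b * f ^ n.toNat, hb'⟩ := by
  rw [zpowAt, Localization.mk_mul, Localization.mk_eq_mk_iff]
  refine Localization.r_of_eq ?_
  simp

/-- On an open set in `D₊(f)`, the quotient of a section of `𝒪(n)` by `f ^ n` is a
regular function. -/
theorem exists_functionValue_eq_mul {f : A} (hf : f ∈ 𝒜 1) {W : (Proj 𝒜).Opens}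
    (hW : W ≤ Proj.basicOpen 𝒜 f) (s : Γ(serreTwist 𝒜 n, W)) :
    ∃ a : Γ(Proj 𝒜, W), ∀ x : W, functionValue 𝒜 a x =
      value 𝒜 s x * zpowAt x.1 (hW x.2) (-n) := by
  have key (x : W) : ∃ (V : (Proj 𝒜).Opens) (_ : x.1 ∈ V) (_ : V ≤ W) (i : ℕ) (a b : 𝒜 i)
      (hb : ∀ y : V, (b : A) ∉ (y.1 : ProjectiveSpectrum 𝒜).asHomogeneousIdeal.toIdeal),
      ∀ (y : V) (hy : y.1 ∈ W), (fracAt y.1 a b (hb y)).val =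
        value 𝒜 s ⟨y.1, hy⟩ * zpowAt y.1 (hW hy) (-n) := by
    obtain ⟨V, hV, iV, i, j, a, b, h, w⟩ :=
      Subtype.property (p := (isLocallyFraction 𝒜 n).pred) s x
    -- Locally the section is `a / b`, and the quotient is `a f ^ n⁻ / (b f ^ n⁺)`, where
    -- `n = n⁺ - n⁻`.
    have e : i + (-n).toNat = j + n.toNat := by omega
    have hb (y : V) : (b : A) * f ^ n.toNat ∉
        (y.1 : ProjectiveSpectrum 𝒜).asHomogeneousIdeal.toIdeal := by
      obtain ⟨hb, -⟩ := w y
      refine Submonoid.mul_mem (Ideal.primeCompl (hp := ProjectiveSpectrum.isPrime y.1) _) hb ?_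
      exact fun h => hW (iV.le y.2)
        (Ideal.IsPrime.mem_of_pow_mem (ProjectiveSpectrum.isPrime y.1) _ h)
    refine ⟨V, hV, iV.le, i + (-n).toNat, ⟨a * f ^ (-n).toNat, ?_⟩, ⟨b * f ^ n.toNat, ?_⟩,
      hb, ?_⟩
    · exact SetLike.mul_mem_graded a.2 (by simpa using SetLike.pow_mem_graded (-n).toNat hf)
    · rw [e]
      exact SetLike.mul_mem_graded b.2 (by simpa using SetLike.pow_mem_graded n.toNat hf)
    · intro y hy
      obtain ⟨hb', hs⟩ := w y
      have hs' : value 𝒜 s ⟨y.1, hy⟩ = _ := hs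
      rw [hs']
      exact (fracAt_val _ _ _ _).trans (mk_mul_zpowAt_neg y.1 (hW hy) n a b hb' (hb y)).symm
  choose V hxV hVW i a b hb hval using key
  refine ⟨⟨fun x => fracAt x.1 (a x) (b x) (hb x ⟨x.1, hxV x⟩), fun x =>
    ⟨V x, hxV x, homOfLE (hVW x), i x, a x, b x, fun y => hb x y, fun y => ?_⟩⟩, fun x => ?_⟩
  · apply HomogeneousLocalization.val_injective
    exact (hval ⟨y.1, hVW x y.2⟩ ⟨y.1, hxV _⟩ (hVW x y.2)).trans (hval x y (hVW x y.2)).symm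
  · exact hval x ⟨x.1, hxV x⟩ x.2

theorem isLocalGenerator_zpow {f : A} (hf : f ∈ 𝒜 1) (n : ℤ) :
    Scheme.Modules.IsLocalGenerator (serreTwist 𝒜 n) (zpow 𝒜 hf n) := by
  intro W h
  have hz (x : W) : value 𝒜 ((serreTwist 𝒜 n).presheaf.map (homOfLE h).op (zpow 𝒜 hf n)) x =
      zpowAt x.1 (h x.2) n := rfl
  constructor
  · intro a b hab
    apply functionValue_injective
    ext x
    have := congr(value 𝒜 $hab x)
    rw [value_smul, value_smul, hz] at this
    exact (IsUnit.of_mul_eq_one_right _ (zpowAt_neg_mul x.1 (h x.2) n)).mul_left_injective this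
  · intro s
    obtain ⟨a, ha⟩ := exists_functionValue_eq_mul hf h s
    refine ⟨a, value_injective (funext fun x => ?_)⟩
    rw [value_smul, hz, ha, mul_assoc]
    exact (congrArg _ (zpowAt_neg_mul x.1 (h x.2) n)).trans (mul_one _)

end SerreTwist
namespace P1

theorem res_xpow_one (n : ℤ) :
    res (serreTwist grading n) 1 (xpow 1 n) =
      ((u ^ n : Γ(P1, U01)ˣ) : Γ(P1, U01)) • res (serreTwist grading n) 0 (xpow 0 n) := by
  apply SerreTwist.value_injective
  ext x
  have h₀ : Units.map (SerreTwist.functionValueHom x) u =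
      SerreTwist.unitAt x.1 (U01_le 1 x.2) * (SerreTwist.unitAt x.1 (U01_le 0 x.2))⁻¹ := by
    refine Units.ext ((ratio01_val 0 1 x).trans ?_)
    refine Eq.trans ?_ (Localization.mk_mul _ _ _ _).symm
    rw [mul_one, one_mul]
  have h₁ := congr(((($h₀) ^ n : (SerreTwist.Loc grading x.1)ˣ) : SerreTwist.Loc grading x.1))
  rw [← map_zpow, mul_zpow, Units.val_mul] at h₁
  rw [SerreTwist.value_smul]
  refine Eq.trans ?_ (congrArg (· * _) h₁).symm
  refine (SerreTwist.zpowAt_eq x.1 (U01_le 1 x.2) n).trans ?_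
  refine Eq.trans ?_ (congrArg _ (SerreTwist.zpowAt_eq x.1 (U01_le 0 x.2) n)).symm
  rw [mul_assoc, ← Units.val_mul, ← mul_zpow, inv_mul_cancel, one_zpow, Units.val_one, mul_one]

end P1
end

/-! ### Functions on the infinitesimal neighbourhoods of the diagonal -/

noncomputable section

open Polynomial

namespace AlgebraicGeometry.Scheme.Hom

theorem appLE_surjective_of_eq {X Y : Scheme.{u}} (f : X ⟶ Y) {W : Y.Opens} {V : X.Opens}
    (h : V = f ⁻¹ᵁ W) (hs : Function.Surjective (f.app W)) :
    Function.Surjective (f.appLE W V h.le) := by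
  subst h
  rwa [← Scheme.Hom.app_eq_appLE]

theorem ker_appLE_of_eq {X Y : Scheme.{u}} (f : X ⟶ Y) {W : Y.Opens} {V : X.Opens}
    (h : V = f ⁻¹ᵁ W) : RingHom.ker (f.appLE W V h.le).hom = RingHom.ker (f.app W).hom := by
  subst h
  rw [← Scheme.Hom.app_eq_appLE]

end AlgebraicGeometry.Scheme.Hom

namespace PrincipalParts
open Limits

theorem isAffineOpen_fst_inf_snd {X S : Scheme.{u}} [IsAffine S] (f : X ⟶ S) {U : X.Opens}
    (hU : IsAffineOpen U) :
    IsAffineOpen (pullback.fst f f ⁻¹ᵁ U ⊓ pullback.snd f f ⁻¹ᵁ U) := by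
  have : IsAffine _ := hU
  have hUS : U ≤ f ⁻¹ᵁ ⊤ := le_top
  have : IsAffine (⊤ : S.Opens) := isAffineOpen_top S
  exact .of_isIso (Scheme.Hom.isPullback_resLE (.of_hasPullback f f) hUS hUS rfl).isoPullback.hom

theorem snd_preimage_eq {X S : Scheme.{u}} (f : X ⟶ S) [IsSeparated f] (k : ℕ) (U : X.Opens) :
    snd f k ⁻¹ᵁ U = incl f k ⁻¹ᵁ (pullback.fst f f ⁻¹ᵁ U ⊓ pullback.snd f f ⁻¹ᵁ U) :=
  le_antisymm (fun _ hx => ⟨(fst_preimage_eq f k U).ge hx, hx⟩) fun _ hx => hx.2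

theorem isAffineOpen_snd_preimage {X S : Scheme.{u}} [IsAffine S] (f : X ⟶ S) [IsSeparated f]
    (k : ℕ) {U : X.Opens} (hU : IsAffineOpen U) : IsAffineOpen (snd f k ⁻¹ᵁ U) := by
  have : IsClosedImmersion (incl f k) :=
    inferInstanceAs (IsClosedImmersion (Scheme.IdealSheafData.subschemeι _))
  rw [snd_preimage_eq]
  exact (isAffineOpen_fst_inf_snd f hU).preimage (incl f k)

/-- Over an affine open `U` whose ring of functions is the polynomial ring `ℤ[a]`, the ring of
functions on `Δ^k` is free over the second factor on `1, da, …, da ^ k`, with `da ^ (k + 1) = 0`. -/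
theorem isPowerBasis_d {X : Scheme.{0}} (f : X ⟶ Spec (.of ℤ)) [IsSeparated f] {U : X.Opens}
    (hU : IsAffineOpen U) (a : Γ(X, U))
    (ha : Function.Bijective (eval₂RingHom (Int.castRingHom Γ(X, U)) a)) (k : ℕ) :
    IsPowerBasis ((snd f k).app U).hom (d (f := f) k a) (k + 1) ∧
      d (f := f) k a ^ (k + 1) = 0 := by
  have H : IsPullback (pullback.fst f f) (pullback.snd f f) f f := .of_hasPullback f f
  let W : (pullback f f).Opens := pullback.fst f f ⁻¹ᵁ U ⊓ pullback.snd f f ⁻¹ᵁ U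
  have hUS : U ≤ f ⁻¹ᵁ ⊤ := le_top
  have hS : IsAffineOpen (⊤ : (Spec (.of ℤ)).Opens) := isAffineOpen_top _
  have hW : IsAffineOpen W := isAffineOpen_fst_inf_snd f hU
  let l : Γ(X, U) ⟶ Γ(pullback f f, W) := (pullback.fst f f).appLE U W inf_le_left
  let r : Γ(X, U) ⟶ Γ(pullback f f, W) := (pullback.snd f f).appLE U W inf_le_right
  have hpush : IsPushout (f.appLE ⊤ U hUS) (f.appLE ⊤ U hUS) l r :=
    (isIso_pushoutSection_iff H hUS hUS rfl).1
      (isIso_pushoutSection_of_isAffineOpen H hUS hUS rfl hS hU hU)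
  have hZ : Function.Bijective (Int.castRingHom Γ(Spec (.of ℤ), ⊤)) := by
    let e := (Scheme.ΓSpecIso (.of ℤ)).symm.commRingCatIsoToRingEquiv
    have : Int.castRingHom Γ(Spec (.of ℤ), ⊤) = e.toRingHom := RingHom.ext_int _ _
    rw [this]
    exact e.bijective
  -- `E` identifies the polynomials over `Γ(X, U)` with the functions on `U × U`, `X ↦ δ`.
  let δ := l.hom a - r.hom a
  have hE := bijective_eval₂_of_isPushout hpush hZ a ha
  let E := RingEquiv.ofBijective (eval₂RingHom r.hom δ) hE
  have hEX : E Polynomial.X = δ := eval₂_X _ _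
  have hdiag : U = pullback.diagonal f ⁻¹ᵁ W := by
    change U = pullback.diagonal f ⁻¹ᵁ (pullback.fst f f ⁻¹ᵁ U) ⊓
      pullback.diagonal f ⁻¹ᵁ (pullback.snd f f ⁻¹ᵁ U)
    rw [← Scheme.Hom.comp_preimage, ← Scheme.Hom.comp_preimage, pullback.diagonal_fst,
      pullback.diagonal_snd]
    simp
  let μ : Γ(pullback f f, W) ⟶ Γ(X, U) := (pullback.diagonal f).appLE W U hdiag.le
  have hid : (𝟙 X : X ⟶ X).appLE U U le_rfl = 𝟙 _ :=
    (Scheme.Hom.appLE_eq_app (𝟙 X)).trans (Scheme.Hom.id_app U)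
  have hl : l ≫ μ = 𝟙 _ := by
    simp [l, μ, Scheme.Hom.appLE_comp_appLE, hid]
  have hr : r ≫ μ = 𝟙 _ := by
    simp [r, μ, Scheme.Hom.appLE_comp_appLE, hid]
  -- Restricting to the diagonal kills `δ`, so on polynomials it is the constant term.
  have hμE (P) : μ.hom (E P) = P.coeff 0 := by
    have : μ.hom.comp (eval₂RingHom r.hom δ) = constantCoeff := by
      refine Polynomial.ringHom_ext (fun x => ?_) ?_
      · simpa using congr($hr x)
      · have h₁ : μ.hom (l.hom a) = a := congr($hl a)
        have h₂ : μ.hom (r.hom a) = a := congr($hr a)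
        simp [δ, h₁, h₂]
    exact congr($this P)
  have hker : (pullback.diagonal f).ker.ideal ⟨W, hW⟩ = Ideal.span {δ} := by
    rw [Scheme.Hom.ker_apply]
    refine (Scheme.Hom.ker_appLE_of_eq _ hdiag).symm.trans ?_
    ext b
    obtain ⟨P, rfl⟩ := E.surjective b
    rw [RingHom.mem_ker, Ideal.mem_span_singleton, ← hEX]
    refine (Eq.congr_left (hμE P)).trans ?_
    rw [← X_dvd_iff, map_dvd_iff]
  have hincl : snd f k ⁻¹ᵁ U = incl f k ⁻¹ᵁ W := snd_preimage_eq f k U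
  let c : Γ(pullback f f, W) ⟶ Γ(nbhd f k, snd f k ⁻¹ᵁ U) := (incl f k).appLE W _ hincl.le
  have hc : Function.Surjective c := Scheme.Hom.appLE_surjective_of_eq _ hincl
    (Scheme.IdealSheafData.subschemeι_app_surjective _ ⟨W, hW⟩)
  have hck : RingHom.ker c.hom = Ideal.span {δ ^ (k + 1)} := by
    refine (Scheme.Hom.ker_appLE_of_eq _ hincl).trans ?_
    refine (Scheme.IdealSheafData.ker_subschemeι_app _ ⟨W, hW⟩).trans ?_
    rw [Scheme.IdealSheafData.ideal_pow, Pi.pow_apply, hker, Ideal.span_singleton_pow]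
  have hcr : r ≫ c = (snd f k).app U := by
    rw [Scheme.Hom.app_eq_appLE]
    exact Scheme.Hom.appLE_comp_appLE ..
  have hcl : l ≫ c = (fst f k).appLE U (snd f k ⁻¹ᵁ U) (fst_preimage_eq f k U).ge :=
    Scheme.Hom.appLE_comp_appLE ..
  have hcδ : c.hom δ = d (f := f) k a := by
    rw [map_sub]
    exact congr($hcl a - $hcr a)
  have hcE : eval₂RingHom ((snd f k).app U).hom (d (f := f) k a) = c.hom.comp E.toRingHom := by
    refine Polynomial.ringHom_ext (fun x => ?_) ?_
    · simpa [E] using congr($hcr x).symm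
    · simpa [E] using hcδ.symm
  refine ⟨isPowerBasis_of_eval₂ _ _ _ ?_ ?_, ?_⟩
  · rw [hcE]
    exact hc.comp E.surjective
  · rw [hcE]
    ext P
    rw [RingHom.mem_ker, Ideal.mem_span_singleton]
    have : c.hom (E P) = 0 ↔ E P ∈ RingHom.ker c.hom := Iff.rfl
    refine this.trans ?_
    rw [hck, Ideal.mem_span_singleton, ← hEX, ← map_pow, map_dvd_iff]
  · rw [← hcδ, ← map_pow, ← RingHom.mem_ker, hck]
    exact Ideal.mem_span_singleton_self _

end PrincipalParts

namespace P1

/-- Homogeneity under scaling of the variables: if `g` and `h` agree on constants and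
`g X_i = t * h X_i`, then `g a = t ^ n * h a` for `a` homogeneous of degree `n`. -/
theorem _root_.MvPolynomial.IsHomogeneous.pow_mul_map_eq {σ R T : Type*} [CommRing R] [CommRing T]
    {n : ℕ} {a : MvPolynomial σ R} (ha : a.IsHomogeneous n) (g h : MvPolynomial σ R →+* T) (t : T)
    (hC : ∀ r, h (MvPolynomial.C r) = g (MvPolynomial.C r))
    (hX : ∀ i, t * h (MvPolynomial.X i) = g (MvPolynomial.X i)) : t ^ n * h a = g a := by
  rw [a.as_sum, map_sum, map_sum, Finset.mul_sum]
  refine Finset.sum_congr rfl fun d hd => ?_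
  have hdeg : d.degree = n := by
    rw [← ha (MvPolynomial.mem_support_iff.1 hd), Finsupp.degree_eq_weight_one]
    rfl
  rw [MvPolynomial.monomial_eq, map_mul, map_mul, hC, Finsupp.prod, map_prod, map_prod, ← hdeg,
    Finsupp.degree_apply, ← Finset.prod_pow_eq_pow_sum, mul_left_comm, ← Finset.prod_mul_distrib]
  congr 1
  refine Finset.prod_congr rfl fun i _ => ?_
  rw [map_pow, map_pow, ← mul_pow, hX]

/-- The ring of functions on `U_i` is the polynomial ring `ℤ[x_j / x_i]`. -/
theorem bijective_eval₂_ratio {i j : Fin 2} (hij : i ≠ j) :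
    Function.Bijective (eval₂RingHom (Int.castRingHom Γ(P1, U i)) (ratio i j)) := by
  let q : HomogeneousLocalization.Away grading (MvPolynomial.X i) :=
    HomogeneousLocalization.Away.mk grading (X_mem i) 1 (MvPolynomial.X j) (by simpa using X_mem j)
  let e := (Proj.basicOpenIsoAway grading (MvPolynomial.X i) (X_mem i)
    one_pos).commRingCatIsoToRingEquiv
  have he : eval₂RingHom (Int.castRingHom Γ(P1, U i)) (ratio i j) =
      e.toRingHom.comp (eval₂RingHom (Int.castRingHom _) q) := by
    refine Polynomial.ringHom_ext (fun x => by simp) ?_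
    simp
    rfl
  rw [he]
  refine e.bijective.comp ⟨?_, ?_⟩
  -- Dehomogenization `x_i ↦ 1`, `x_j ↦ X` is a left inverse, which gives injectivity.
  · let ev : Fin 2 → ℤ[X] := fun l => if l = i then 1 else X
    let g : MvPolynomial (Fin 2) ℤ →+* ℤ[X] := (MvPolynomial.aeval ev).toRingHom
    have hgi : g (MvPolynomial.X i) = 1 := by simp [g, ev]
    have hgj : g (MvPolynomial.X j) = X := by simp [g, ev, hij.symm]
    have hu : IsUnit (g (MvPolynomial.X i)) := hgi ▸ isUnit_one
    let θ : Localization.Away (MvPolynomial.X i : MvPolynomial (Fin 2) ℤ) →+* ℤ[X] :=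
      IsLocalization.Away.lift (MvPolynomial.X i) hu
    let θ' : HomogeneousLocalization.Away grading (MvPolynomial.X i) →+* ℤ[X] :=
      θ.comp (algebraMap _ (Localization.Away (MvPolynomial.X i : MvPolynomial (Fin 2) ℤ)))
    have hq : θ' q = X := by
      have h₁ : θ' q = θ (IsLocalization.mk' _ (MvPolynomial.X j)
          (⟨MvPolynomial.X i ^ 1, 1, rfl⟩ :
            Submonoid.powers (MvPolynomial.X i : MvPolynomial (Fin 2) ℤ))) := by
        rw [← Localization.mk_eq_mk']
        exact congrArg θ (HomogeneousLocalization.Away.val_mk grading 1 (X_mem i) _ _)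
      rw [h₁]
      refine (IsLocalization.lift_mk'_spec _ _ _ _).2 ?_
      simp [hgi, hgj]
    have : θ'.comp (eval₂RingHom (Int.castRingHom _) q) = RingHom.id _ := by
      refine Polynomial.ringHom_ext (fun x => by simp) ?_
      simpa using hq
    exact Function.LeftInverse.injective (g := θ') fun P => congr($this P)
  -- A fraction `a / x_i ^ n` is the value at `x_j / x_i` of the dehomogenization of `a`.
  · intro x
    obtain ⟨n, a, ha, rfl⟩ := HomogeneousLocalization.Away.mk_surjective grading (X_mem i) x
    let ev : Fin 2 → ℤ[X] := fun l => if l = i then 1 else X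
    let g : MvPolynomial (Fin 2) ℤ →+* ℤ[X] := (MvPolynomial.aeval ev).toRingHom
    let α : HomogeneousLocalization.Away grading (MvPolynomial.X i) →+*
      Localization.Away (MvPolynomial.X i : MvPolynomial (Fin 2) ℤ) := algebraMap _ _
    let β := algebraMap (MvPolynomial (Fin 2) ℤ)
      (Localization.Away (MvPolynomial.X i : MvPolynomial (Fin 2) ℤ))
    have hmk (m : ℕ) (b : MvPolynomial (Fin 2) ℤ) (hb) :
        β (MvPolynomial.X i) ^ m * α (HomogeneousLocalization.Away.mk grading (X_mem i) m b hb) =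
          β b := by
      have : α (HomogeneousLocalization.Away.mk grading (X_mem i) m b hb) =
          IsLocalization.mk' _ b (⟨MvPolynomial.X i ^ m, m, rfl⟩ : Submonoid.powers _) := by
        rw [← Localization.mk_eq_mk']
        exact HomogeneousLocalization.Away.val_mk grading m (X_mem i) _ _
      rw [this, mul_comm, ← map_pow]
      exact IsLocalization.mk'_spec _ _ _
    have hunit : IsUnit (β (MvPolynomial.X i) ^ n) :=
      (IsLocalization.Away.algebraMap_isUnit (MvPolynomial.X i)).pow n
    refine ⟨g a, HomogeneousLocalization.val_injective _ (hunit.mul_right_injective ?_)⟩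
    refine Eq.trans ?_ (hmk n a ha).symm
    have ha' : a.IsHomogeneous n := by simpa using ha
    refine ha'.pow_mul_map_eq β ((α.comp (eval₂RingHom (Int.castRingHom _) q)).comp g) _ ?_ ?_
    · intro r
      simp
    · intro l
      by_cases hl : l = i
      · subst hl
        simp [g, ev]
      · have : l = j := by omega
        subst this
        simpa [g, ev, hl] using hmk 1 (MvPolynomial.X l) (by simpa using X_mem l)

end P1
end

/-! ### Bases of principal parts and the change of basis -/

noncomputable section

theorem Module.Basis.exists_of_bijective {R M : Type*} [CommRing R] [AddCommGroup M] [Module R M]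
    {m : ℕ} (v : Fin m → M) (h : Function.Bijective fun c : Fin m → R => ∑ j, c j • v j) :
    ∃ b : Module.Basis (Fin m) R M, ∀ j, b j = v j := by
  refine ⟨.ofEquivFun (LinearEquiv.ofBijective (Fintype.linearCombination R v) h).symm,
    fun j => ?_⟩
  rw [Module.Basis.coe_ofEquivFun]
  refine (Fintype.linearCombination_apply_single R v j 1).trans (one_smul _ _)

namespace PrincipalParts

section
variable {X S : Scheme.{u}} (f : X ⟶ S) (k : ℕ) (E : X.Modules)

theorem smul_eq_app_smul {U : X.Opens} (r : Γ(X, U)) (s : Γ(right f k E, U)) :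
    r • s = (snd f k).app U r • s := rfl

theorem map_nbhd_smul {U V : X.Opens} (i : U ⟶ V) (r : Γ(nbhd f k, snd f k ⁻¹ᵁ V))
    (s : Γ(right f k E, V)) : (right f k E).presheaf.map i.op (r • s) =
      (nbhd f k).presheaf.map ((Opens.map (snd f k).base).map i).op r •
        (right f k E).presheaf.map i.op s :=
  Scheme.Modules.map_smul ((Scheme.Modules.pullback (snd f k)).obj E)
    ((Opens.map (snd f k).base).map i) r s

theorem app_map {U V : X.Opens} (i : U ⟶ V) (a : Γ(X, V)) :
    (snd f k).app U (X.presheaf.map i.op a) =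
      (nbhd f k).presheaf.map ((Opens.map (snd f k).base).map i).op ((snd f k).app V a) :=
  congr($((snd f k).naturality i.op) a)

theorem map_d [IsSeparated f] {U V : X.Opens} (i : U ⟶ V) (a : Γ(X, V)) :
    (nbhd f k).presheaf.map ((Opens.map (snd f k).base).map i).op (d (f := f) k a) =
      d (f := f) k (X.presheaf.map i.op a) := by
  rw [d, d, map_sub, app_map]
  congr 1
  have h₁ := (fst f k).appLE_map (fst_preimage_eq f k V).ge
    ((Opens.map (snd f k).base).map i).op
  have h₂ := (fst f k).map_appLE (fst_preimage_eq f k U).ge i.op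
  exact congr($(h₁.trans h₂.symm) a)

theorem map_dPowTensor [IsSeparated f] {U V : X.Opens} (i : U ⟶ V) (a : Γ(X, V)) (p : ℕ)
    (s : Γ(E, V)) : (right f k E).presheaf.map i.op (dPowTensor f k a p s) =
      d (f := f) k (X.presheaf.map i.op a) ^ p • (right f k E).presheaf.map i.op
        (oneTensor f k s) := by
  rw [dPowTensor, map_nbhd_smul, map_pow, map_d]

variable {E}

theorem map_oneTensor {U V : X.Opens} (i : U ⟶ V) (s : Γ(E, V)) :
    (right f k E).presheaf.map i.op (oneTensor f k s) = oneTensor f k (E.presheaf.map i.op s) :=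
  (Scheme.Modules.map_app _ i s).symm

theorem oneTensor_smul {U : X.Opens} (a : Γ(X, U)) (s : Γ(E, U)) :
    oneTensor f k (a • s) = a • oneTensor f k s :=
  Scheme.Modules.Hom.app_smul _ _ _

/-- A power basis `δ ^ j` of the functions on `Δ^k` over `W`, together with a generator `e` of `E`,
gives the basis `δ ^ j • (1 ⊗ e)` of the principal parts over `W`. -/
theorem bijective_sum_smul_pow_smul {U W : X.Opens} {e : Γ(E, U)}
    (he : Scheme.Modules.IsLocalGenerator E e) (h : W ≤ U) {δ : Γ(nbhd f k, snd f k ⁻¹ᵁ W)} {m : ℕ}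
    (hδ : IsPowerBasis ((snd f k).app W).hom δ m) :
    Function.Bijective fun c : Fin m → Γ(X, W) => ∑ j, c j • (δ ^ (j : ℕ) •
      (right f k E).presheaf.map (homOfLE h).op (oneTensor f k e)) := by
  have h₁ := (he.pullback (snd f k) (snd f k ⁻¹ᵁ W) (fun x hx => h hx)).comp hδ
  convert! h₁ using 1
  ext c
  refine Eq.trans ?_ (Finset.sum_smul (R := Γ(nbhd f k, snd f k ⁻¹ᵁ W))
    (M := Γ(right f k E, W))).symm
  refine Finset.sum_congr rfl fun j _ => ?_
  rw [smul_eq_app_smul]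
  exact smul_smul (α := Γ(right f k E, W)) _ _ _

end

/-- The power basis given by `da` persists on the basic open where `a` is invertible: there `Δ^k` is
the basic open of `1 ⊗ a`, so both rings are localized. -/
theorem isPowerBasis_d_basicOpen {X : Scheme.{0}} (f : X ⟶ Spec (.of ℤ)) [IsSeparated f]
    {U : X.Opens} (hU : IsAffineOpen U) (a : Γ(X, U)) (k : ℕ)
    (h : IsPowerBasis ((snd f k).app U).hom (d (f := f) k a) (k + 1))
    {V : X.Opens} (i : V ⟶ U) (hV : V = X.basicOpen a) :
    IsPowerBasis ((snd f k).app V).hom (d (f := f) k (X.presheaf.map i.op a)) (k + 1) := by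
  rw [← map_d]
  refine h.away a (X.presheaf.map i.op).hom
    ((nbhd f k).presheaf.map ((Opens.map (snd f k).base).map i).op).hom _ ?_ ?_ ?_
  · ext x
    exact app_map f k i x
  · exact hU.isLocalization_of_eq_basicOpen a i hV
  · refine (isAffineOpen_snd_preimage f k hU).isLocalization_of_eq_basicOpen _ _ ?_
    rw [hV, Scheme.preimage_basicOpen]

end PrincipalParts

namespace P1
open PrincipalParts

theorem ratio_val (i j : Fin 2) (x : U i) :
    SerreTwist.functionValue grading (ratio i j) x =
      Localization.mk (MvPolynomial.X j) ⟨MvPolynomial.X i, x.2⟩ := by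
  refine (ProjectiveSpectrum.Proj.awayToSection_apply grading (MvPolynomial.X i)
    (HomogeneousLocalization.Away.mk grading (X_mem i) 1 (MvPolynomial.X j)
      (by simpa using X_mem j)) x).trans ?_
  rw [HomogeneousLocalization.Away.val_mk, Localization.mk_eq_mk', IsLocalization.map_mk',
    ← Localization.mk_eq_mk']
  refine Localization.mk_eq_mk_iff.mpr (Localization.r_of_eq ?_)
  simp

theorem U01_eq_basicOpen {i j : Fin 2} (hij : i ≠ j) : U01 = P1.basicOpen (ratio i j) := by
  apply le_antisymm
  · have h := P1.basicOpen_res (ratio i j) (homOfLE (U01_le i)).op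
    have hu : P1.basicOpen (ratio01 i j) = U01 :=
      Scheme.basicOpen_of_isUnit _ (IsUnit.of_mul_eq_one _ (ratio01_mul i j))
    exact inf_eq_left.1 (h.symm.trans hu)
  · have key : P1.basicOpen (ratio i j) ≤ U j := by
      intro x hx
      have hxi : x ∈ U i := P1.basicOpen_le _ hx
      have hu := (RingedSpace.isUnit_res_basicOpen P1.toSheafedSpace (ratio i j)).map
        (SerreTwist.functionValueHom (𝒜 := grading) ⟨x, hx⟩)
      have hv : SerreTwist.functionValueHom (𝒜 := grading) ⟨x, hx⟩
          (P1.presheaf.map (homOfLE (P1.basicOpen_le (ratio i j))).op (ratio i j)) =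
          Localization.mk (MvPolynomial.X j) ⟨MvPolynomial.X i, hxi⟩ :=
        ratio_val i j ⟨x, hxi⟩
      exact SerreTwist.notMem_of_isUnit_mk x hxi ((congrArg IsUnit hv).mp hu)
    have key' := P1.basicOpen_le (ratio i j)
    fin_cases i <;> fin_cases j <;> first | exact absurd rfl hij | skip
    · exact le_inf key' key
    · exact le_inf key key'

theorem isAffineOpen_U (i : Fin 2) : IsAffineOpen (U i) :=
  Proj.isAffineOpen_basicOpen grading (MvPolynomial.X i) (X_mem i) one_pos

theorem isLocalGenerator_xpow (i : Fin 2) (n : ℤ) :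
    Scheme.Modules.IsLocalGenerator (serreTwist grading n) (xpow i n) :=
  SerreTwist.isLocalGenerator_zpow (X_mem i) n

theorem isPowerBasis_d_ratio {i j : Fin 2} (hij : i ≠ j) (k : ℕ) :
    IsPowerBasis ((snd toSpecZ k).app (U i)).hom (d (f := toSpecZ) k (ratio i j)) (k + 1) :=
  (isPowerBasis_d toSpecZ (isAffineOpen_U i) _ (bijective_eval₂_ratio hij) k).1

theorem isPowerBasis_d_ratio01 {i j : Fin 2} (hij : i ≠ j) (k : ℕ) :
    IsPowerBasis ((snd toSpecZ k).app U01).hom (d (f := toSpecZ) k (ratio01 i j)) (k + 1) :=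
  isPowerBasis_d_basicOpen toSpecZ (isAffineOpen_U i) _ k (isPowerBasis_d_ratio hij k) _
    (U01_eq_basicOpen hij)

theorem d_ratio01_pow_eq_zero (k : ℕ) :
    d (f := toSpecZ) k (ratio01 0 1) ^ (k + 1) = 0 := by
  have h := (isPowerBasis_d toSpecZ (isAffineOpen_U 0) _
    (bijective_eval₂_ratio zero_ne_one) k).2
  rw [ratio01, ← map_d, ← map_pow, h, map_zero]

/-- The basis of `Pr^k(𝒪(n))(U_i)` consisting of the powers of `d(x_j / x_i)`. -/
theorem exists_basis {i j : Fin 2} (hij : i ≠ j) (n : ℤ) (k : ℕ) :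
    ∃ b : Module.Basis (Fin (k + 1)) Γ(P1, U i) Γ(Pr n k, U i),
      ∀ p, b p = dPowTensor toSpecZ k (ratio i j) p (xpow i n) := by
  refine Module.Basis.exists_of_bijective _ ?_
  have := bijective_sum_smul_pow_smul toSpecZ k (isLocalGenerator_xpow i n) le_rfl
    (isPowerBasis_d_ratio hij k)
  have h : (right toSpecZ k (serreTwist grading n)).presheaf.map (homOfLE (le_refl (U i))).op =
    𝟙 _ := (right toSpecZ k (serreTwist grading n)).presheaf.map_id _
  rw [h] at this
  exact this

/-- The basis of `exists_basis` restricts to a basis over `U_0 ∩ U_1`. -/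
theorem exists_basis01 {i j : Fin 2} (hij : i ≠ j) (n : ℤ) (k : ℕ) :
    ∃ b : Module.Basis (Fin (k + 1)) Γ(P1, U01) Γ(Pr n k, U01),
      ∀ p, b p = res (Pr n k) i (dPowTensor toSpecZ k (ratio i j) p (xpow i n)) := by
  refine Module.Basis.exists_of_bijective _ ?_
  have := bijective_sum_smul_pow_smul toSpecZ k (isLocalGenerator_xpow i n) (U01_le i)
    (isPowerBasis_d_ratio01 hij k)
  convert! this using 5
  exact map_dPowTensor toSpecZ k _ _ _ _ _

theorem res_one (n : ℤ) (k : ℕ) : res (Pr n k) 1 (one 1 n k) =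
    ((u ^ n : Γ(P1, U01)ˣ) : Γ(P1, U01)) • res (Pr n k) 0 (one 0 n k) := by
  have h := congrArg (oneTensor toSpecZ k) (res_xpow_one n)
  rw [oneTensor_smul] at h
  refine (map_oneTensor toSpecZ k _ _).trans (h.trans ?_)
  congr 1
  exact (map_oneTensor toSpecZ k _ _).symm

/-- In terms of the left factor: `x_1 / x_0 ⊗ 1` and `x_0 / x_1 ⊗ 1` are inverse to each other. -/
theorem fst_mul_fst {k : ℕ} :
    ((snd toSpecZ k).app U01 (ratio01 0 1) + d (f := toSpecZ) k (ratio01 0 1)) *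
      ((snd toSpecZ k).app U01 (ratio01 1 0) + d (f := toSpecZ) k (ratio01 1 0)) = 1 := by
  rw [d, d, add_sub_cancel, add_sub_cancel, ← map_mul, ratio01_mul, map_one]

theorem d_ratio01_pow {k p : ℕ} (hp : 1 ≤ p) :
    d (f := toSpecZ) k (ratio01 1 0) ^ p = ∑ j ∈ Finset.Icc p k,
      (snd toSpecZ k).app U01 ((-1) ^ j * ((j - 1).choose (p - 1) : Γ(P1, U01)) *
        ((u ^ (-(p : ℤ) - j) : Γ(P1, U01)ˣ) : Γ(P1, U01))) *
          d (f := toSpecZ) k (ratio01 0 1) ^ j := by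
  let g : Γ(P1, U01) →* Γ(nbhd toSpecZ k, snd toSpecZ k ⁻¹ᵁ U01) := ((snd toSpecZ k).app U01).hom
  have h := sub_inv_pow_eq_sum (Units.map g u) _ _ k (d_ratio01_pow_eq_zero k) fst_mul_fst p hp
  -- The inverse of `1 ⊗ u` is `1 ⊗ v`.
  have hinv : (((Units.map g u)⁻¹ : (Γ(nbhd toSpecZ k, snd toSpecZ k ⁻¹ᵁ U01))ˣ) :
      Γ(nbhd toSpecZ k, snd toSpecZ k ⁻¹ᵁ U01)) = (snd toSpecZ k).app U01 (ratio01 1 0) := by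
    rw [← map_inv]
    rfl
  rw [hinv, add_sub_cancel_left] at h
  rw [h]
  refine Finset.sum_congr rfl fun j _ => ?_
  rw [← map_zpow, map_mul, map_mul, map_pow, map_neg, map_one, map_natCast]
  rfl

theorem res_dv (n : ℤ) {k p : ℕ} (hp : 1 ≤ p) :
    res (Pr n k) 1 (dv n k p) = ∑ j ∈ Finset.Icc p k,
      ((-1) ^ j * ((j - 1).choose (p - 1) : Γ(P1, U01)) *
        ((u ^ (n - p - j) : Γ(P1, U01)ˣ) : Γ(P1, U01))) • res (Pr n k) 0 (du n k j) := by
  have h₁ : res (Pr n k) 1 (dv n k p) =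
      d (f := toSpecZ) k (ratio01 1 0) ^ p • res (Pr n k) 1 (one 1 n k) :=
    map_dPowTensor toSpecZ k _ _ _ _ _
  have h₀ (j : ℕ) : res (Pr n k) 0 (du n k j) =
      d (f := toSpecZ) k (ratio01 0 1) ^ j • res (Pr n k) 0 (one 0 n k) :=
    map_dPowTensor toSpecZ k _ _ _ _ _
  rw [h₁, d_ratio01_pow hp, res_one, smul_eq_app_smul, smul_smul, Finset.sum_mul, Finset.sum_smul]
  refine Finset.sum_congr rfl fun j _ => ?_
  rw [h₀, smul_eq_app_smul, smul_smul, mul_right_comm, ← map_mul]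
  have hexp : -(p : ℤ) - j + n = n - p - j := by ring
  rw [mul_assoc, ← Units.val_mul, ← zpow_add, hexp]

theorem res_dv_zero (n : ℤ) (k : ℕ) : res (Pr n k) 1 (dv n k 0) = res (Pr n k) 1 (one 1 n k) := by
  rw [dv, dPowTensor, pow_zero, one_smul]
  rfl

theorem res_du_zero (n : ℤ) (k : ℕ) : res (Pr n k) 0 (du n k 0) = res (Pr n k) 0 (one 0 n k) := by
  rw [du, dPowTensor, pow_zero, one_smul]
  rfl

theorem res_dv_eq_sum_R (n : ℤ) (k : ℕ) (p : Fin (k + 1)) :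
    res (Pr n k) 1 (dv n k p) = ∑ j, R n k j p • res (Pr n k) 0 (du n k j) := by
  by_cases hp : (p : ℕ) = 0
  · obtain rfl : p = 0 := Fin.ext hp
    rw [hp, res_dv_zero, res_one, Finset.sum_eq_single 0]
    · rw [Fin.val_zero, res_du_zero]
      simp [R]
    · intro j _ hj
      simp [R, hj]
    · simp
  · rw [res_dv n (Nat.one_le_iff_ne_zero.2 hp)]
    let F : ℕ → Γ(Pr n k, U01) := fun j => if (p : ℕ) ≤ j then
      ((-1) ^ j * ((j - 1).choose (p - 1) : Γ(P1, U01)) *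
        ((u ^ (n - (p : ℕ) - j) : Γ(P1, U01)ˣ) : Γ(P1, U01))) • res (Pr n k) 0 (du n k j) else 0
    have hF : ∑ j : Fin (k + 1), R n k j p • res (Pr n k) 0 (du n k j) =
        ∑ j ∈ Finset.range (k + 1), F j := by
      rw [← Fin.sum_univ_eq_sum_range]
      refine Finset.sum_congr rfl fun j _ => ?_
      simp only [R, Matrix.of_apply, hp, if_false, F]
      split_ifs
      · rfl
      · exact zero_smul _ _
    rw [hF, ← Finset.sum_filter]
    refine Finset.sum_congr ?_ fun _ _ => rfl
    ext j
    simp only [Finset.mem_Icc, Finset.mem_filter, Finset.mem_range]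
    omega

end P1

end

theorem mainTheorem3 (n : ℤ) (k : ℕ) (hk : 1 ≤ k) :
    (∃ (D : Module.Basis (Fin (k + 1)) Γ(P1, P1.U 0) Γ(P1.Pr n k, P1.U 0))
       (D' : Module.Basis (Fin (k + 1)) Γ(P1, P1.U 1) Γ(P1.Pr n k, P1.U 1))
       (D₀₁ D'₀₁ : Module.Basis (Fin (k + 1)) Γ(P1, P1.U01) Γ(P1.Pr n k, P1.U01)),
      (∀ j, D j = P1.du n k j) ∧ (∀ p, D' p = P1.dv n k p) ∧
      (∀ j, D₀₁ j = P1.res (P1.Pr n k) 0 (D j)) ∧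
      (∀ p, D'₀₁ p = P1.res (P1.Pr n k) 1 (D' p)) ∧
      D₀₁.toMatrix D'₀₁ = P1.R n k) ∧
    P1.res (P1.Pr n k) 1 (P1.one 1 n k) =
      ((P1.u ^ n : Γ(P1, P1.U01)ˣ) : Γ(P1, P1.U01)) • P1.res (P1.Pr n k) 0 (P1.one 0 n k) ∧
    ∀ p : ℕ, 1 ≤ p → p ≤ k →
      P1.res (P1.Pr n k) 1 (P1.dv n k p) =
        ∑ j ∈ Finset.Icc p k,
          ((-1) ^ j * ((j - 1).choose (p - 1) : Γ(P1, P1.U01)) *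
            ((P1.u ^ (n - p - j) : Γ(P1, P1.U01)ˣ) : Γ(P1, P1.U01))) •
              P1.res (P1.Pr n k) 0 (P1.du n k j) := by
  obtain ⟨D, hD⟩ := P1.exists_basis zero_ne_one n k
  obtain ⟨D', hD'⟩ := P1.exists_basis one_ne_zero n k
  obtain ⟨D₀₁, hD₀₁⟩ := P1.exists_basis01 zero_ne_one n k
  obtain ⟨D'₀₁, hD'₀₁⟩ := P1.exists_basis01 one_ne_zero n k
  refine ⟨⟨D, D', D₀₁, D'₀₁, hD, hD', fun j => ?_, fun p => ?_, ?_⟩, P1.res_one n k,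
    fun p hp _ => P1.res_dv n hp⟩
  · rw [hD, hD₀₁]
  · rw [hD', hD'₀₁]
  · ext j p
    have h : D'₀₁ p = ∑ j, P1.R n k j p • D₀₁ j := by
      rw [hD'₀₁]
      simp only [hD₀₁]
      exact P1.res_dv_eq_sum_R n k p
    rw [Module.Basis.toMatrix_apply, h, D₀₁.repr_sum_self]
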